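/- Let $q$ be a prime power, let $\mathbb F_q$ be the field with $q$ elements, and let $n\ge 2$. Let $\tau$ be the transpose inverse map $x\mapsto (x^{tr})^{-1}$ of a general linear group; it is an automorphism. For a group $G$ and an automorphism $\alpha$ of $G$, let $G\langle\alpha\rangle$ be the semidirect product of $G$ with the cyclic group $\langle\alpha\rangle\le\mathrm{Aut}(G)$. (a) Every element of $\mathrm{GL}_n(q)$ is conjugate to its inverse in $\mathrm{GL}_n(q)\langle\tau\rangle$. (b) Let $\mathrm{GU}_n(q)$ be the group of all $x\in\mathrm{GL}_n(q^2)$ with $(x^{(q)})^{tr}\,x=1$, where $x^{(q)}$ is obtained from $x$ by raising every entry to the $q$-th power; the map $\tau$ of $\mathrm{GL}_n(q^2)$ restricts to an automorphism, again denoted $\tau$, of $\mathrm{GU}_n(q)$. Every element of $\mathrm{GU}_n(q)$ is conjugate to its inverse in $\mathrm{GU}_n(q)\langle\tau\rangle$. (c) Let $B$ be a nondegenerate alternating bilinear form on a $2n$-dimensional vector space over $\mathbb F_q$, let $\mathrm{Sp}(2n,q)$ be the group of invertible linear maps preserving $B$, and let $\mathrm{CSp}(2n,q)$ be the group of invertible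 linear maps preserving $B$ up to a nonzero scalar multiple. For every $g\in\mathrm{Sp}(2n,q)$ there is $h\in\mathrm{CSp}(2n,q)$ with $hgh^{-1}=g^{-1}$. (d) Let $Q$ be a nondegenerate quadratic form on an $n$-dimensional vector space over $\mathbb F_q$ (in any characteristic; nondegenerate means that no nonzero vector $v$ satisfies both $Q(v)=0$ and $Q(v+w)=Q(w)$ for all $w$, and that the radical of the polar form of $Q$ has dimension at most $1$). Then every element of the group of invertible linear maps preserving $Q$ is conjugate to its inverse in that group. These groups are the groups $\mathrm O^{\epsilon}(n,q)$, with $\epsilon\in\{+,-\}$ for $n$ even and $\epsilon=\circ$ for $n$ odd. -/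

import Mathlib

open scoped Matrix MatrixGroups

noncomputable section

namespace ClassicalReality

/-- The group `G⟨α⟩` : the extension of `G` by the cyclic group of automorphisms generated by
`α`, i.e. the semidirect product `G ⋊ ⟨α⟩` with `⟨α⟩ ≤ Aut G` acting in the natural way. -/
abbrev ExtByAut (G : Type*) [Group G] (α : MulAut G) : Type _ :=
  G ⋊[(Subgroup.zpowers α).subtype] (Subgroup.zpowers α)

/-- The transpose of an invertible matrix, as an invertible matrix. -/
def glTranspose {n : ℕ} {R : Type*} [CommRing R] (x : GL (Fin n) R) : GL (Fin n) R where
  val := (x : Matrix (Fin n) (Fin n) R)ᵀ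
  inv := ((x⁻¹ : GL (Fin n) R) : Matrix (Fin n) (Fin n) R)ᵀ
  val_inv := by
    rw [← Matrix.transpose_mul, ← Units.val_mul, inv_mul_cancel, Units.val_one,
      Matrix.transpose_one]
  inv_val := by
    rw [← Matrix.transpose_mul, ← Units.val_mul, mul_inv_cancel, Units.val_one,
      Matrix.transpose_one]

theorem glTranspose_mul {n : ℕ} {R : Type*} [CommRing R] (x y : GL (Fin n) R) :
    glTranspose (x * y) = glTranspose y * glTranspose x :=
  Units.ext (Matrix.transpose_mul _ _)

theorem glTranspose_glTranspose {n : ℕ} {R : Type*} [CommRing R] (x : GL (Fin n) R) :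
    glTranspose (glTranspose x) = x :=
  Units.ext (Matrix.transpose_transpose _)

theorem glTranspose_inv {n : ℕ} {R : Type*} [CommRing R] (x : GL (Fin n) R) :
    glTranspose x⁻¹ = (glTranspose x)⁻¹ :=
  rfl

/-- The transpose inverse map `τ : x ↦ (xᵗʳ)⁻¹`, an automorphism of `GL_n(R)`. -/
def tau (n : ℕ) (R : Type*) [CommRing R] : MulAut (GL (Fin n) R) where
  toFun x := (glTranspose x)⁻¹
  invFun x := (glTranspose x)⁻¹
  left_inv x := by
    change (glTranspose (glTranspose x)⁻¹)⁻¹ = x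
    rw [glTranspose_inv, inv_inv, glTranspose_glTranspose]
  right_inv x := by
    change (glTranspose (glTranspose x)⁻¹)⁻¹ = x
    rw [glTranspose_inv, inv_inv, glTranspose_glTranspose]
  map_mul' x y := by
    rw [glTranspose_mul, mul_inv_rev]

/-- The automorphism of `GL_n(K)` raising every matrix entry to the `|F|`-th power. -/
def frob (n : ℕ) (F K : Type*) [Field F] [Fintype F] [Field K] [Algebra F K] :
    GL (Fin n) K →* GL (Fin n) K :=
  Matrix.GeneralLinearGroup.map (FiniteField.frobeniusAlgHom F K : K →+* K)

/-- The general unitary group `GU_n(q)`, where `q = |F|` and `K` is the quadratic extension of `F`: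
the matrices `x ∈ GL_n(q²)` with `(x^(q))ᵗʳ x = 1`, where `x^(q)` is obtained from `x` by raising
every entry to the `q`-th power. -/
def GU (n : ℕ) (F K : Type*) [Field F] [Fintype F] [Field K] [Algebra F K] :
    Subgroup (GL (Fin n) K) where
  carrier := {x | glTranspose (frob n F K x) * x = 1}
  one_mem' := by
    rw [Set.mem_ofPred_eq, map_one, mul_one]
    exact Units.ext Matrix.transpose_one
  mul_mem' {x y} hx hy := by
    rw [Set.mem_ofPred_eq] at hx hy ⊢
    rw [map_mul, glTranspose_mul, mul_assoc, ← mul_assoc _ x y, hx, one_mul, hy]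
  inv_mem' {x} hx := by
    rw [Set.mem_ofPred_eq] at hx ⊢
    rw [map_inv, glTranspose_inv, ← mul_inv_rev, inv_eq_one]
    exact mul_eq_one_comm.mp hx

theorem frob_tau {n : ℕ} {F K : Type*} [Field F] [Fintype F] [Field K] [Algebra F K]
    (x : GL (Fin n) K) : frob n F K (tau n K x) = tau n K (frob n F K x) := by
  change frob n F K (glTranspose x)⁻¹ = (glTranspose (frob n F K x))⁻¹
  rw [map_inv]
  rfl

theorem tau_mem_GU {n : ℕ} {F K : Type*} [Field F] [Fintype F] [Field K] [Algebra F K]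
    {x : GL (Fin n) K} (hx : x ∈ GU n F K) : tau n K x ∈ GU n F K := by
  have h : glTranspose (frob n F K x) * x = 1 := hx
  change glTranspose (frob n F K (tau n K x)) * tau n K x = 1
  rw [frob_tau]
  change (glTranspose (glTranspose (frob n F K x)))⁻¹ * (glTranspose x)⁻¹ = 1
  rw [← mul_inv_rev, ← glTranspose_mul, h, inv_eq_one]
  exact Units.ext Matrix.transpose_one

/-- The restriction of the transpose inverse map `τ` of `GL_n(q²)` to `GU_n(q)`. -/
def tauGU (n : ℕ) (F K : Type*) [Field F] [Fintype F] [Field K] [Algebra F K] :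
    MulAut (GU n F K) where
  toFun x := ⟨tau n K x, tau_mem_GU x.2⟩
  invFun x := ⟨tau n K x, tau_mem_GU x.2⟩
  left_inv x := Subtype.ext ((tau n K).left_inv x.1)
  right_inv x := Subtype.ext ((tau n K).right_inv x.1)
  map_mul' x y := Subtype.ext (map_mul (tau n K) x.1 y.1)

/-- The symplectic group of a bilinear form `B`: the invertible linear maps preserving `B`. -/
def Sp {F V : Type*} [Field F] [AddCommGroup V] [Module F V] (B : LinearMap.BilinForm F V) :
    Subgroup (V ≃ₗ[F] V) where
  carrier := {g | ∀ v w, B (g v) (g w) = B v w}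
  one_mem' := fun _ _ => rfl
  mul_mem' {g h} hg hh := fun v w => (hg (h v) (h w)).trans (hh v w)
  inv_mem' {g} hg := fun v w => by
    have e (u : V) : g (g⁻¹ u) = u := g.apply_symm_apply u
    rw [← hg (g⁻¹ v) (g⁻¹ w), e, e]

/-- The conformal symplectic group of a bilinear form `B`: the invertible linear maps preserving
`B` up to a (nonzero) scalar multiple. -/
def CSp {F V : Type*} [Field F] [AddCommGroup V] [Module F V] (B : LinearMap.BilinForm F V) :
    Subgroup (V ≃ₗ[F] V) where
  carrier := {g | ∃ c : Fˣ, ∀ v w, B (g v) (g w) = c * B v w}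
  one_mem' := ⟨1, fun v w => by simp⟩
  mul_mem' := by
    rintro g h ⟨c, hg⟩ ⟨d, hh⟩
    exact ⟨c * d, fun v w => (hg (h v) (h w)).trans (by rw [hh, Units.val_mul, mul_assoc])⟩
  inv_mem' := by
    rintro g ⟨c, hg⟩
    refine ⟨c⁻¹, fun v w => ?_⟩
    have e (u : V) : g (g⁻¹ u) = u := g.apply_symm_apply u
    have h := hg (g⁻¹ v) (g⁻¹ w)
    rw [e, e] at h
    rw [h, Units.inv_mul_cancel_left]

/-- The orthogonal group of a quadratic form `Q`: the invertible linear maps preserving `Q`. -/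
def O {F V : Type*} [Field F] [AddCommGroup V] [Module F V] (Q : QuadraticForm F V) :
    Subgroup (V ≃ₗ[F] V) where
  carrier := {g | ∀ v, Q (g v) = Q v}
  one_mem' := fun _ => rfl
  mul_mem' {g h} hg hh := fun v => (hg (h v)).trans (hh v)
  inv_mem' {g} hg := fun v => by
    have e (u : V) : g (g⁻¹ u) = u := g.apply_symm_apply u
    rw [← hg (g⁻¹ v), e]

end ClassicalReality

end

/-! All four parts rest on `exists_reversal`. Let a commutative principal ideal algebra `A` with
involution `s` act on a finite-dimensional space with a nondegenerate `ε`-symmetric form `B`, so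
that `a` and `s a` are adjoint. Then some `s`-semilinear `h` satisfies `B (h x) (h y) = B y x`. When
an isometry `g` acts as the variable of a Laurent polynomial ring and `s` inverts that variable,
semilinearity says exactly that `h` conjugates `g` to `g⁻¹`.

To prove it, split off nondegenerate submodules orthogonally until none is left. The module is then
generated by one vector `u`, where `a • u ↦ s a • u` works, or by two vectors, where the same
formula needs a twist on the second generator.

For symplectic forms `ε = -1`, and `h` scales the form by `-1`. For unitary groups the trace of the
Hermitian form is used; `h` is a unitary matrix composed with Frobenius, and Frobenius agrees with
`τ` on the group. For `GL`, a pairing on two copies of `F^n` gives the similarity of a matrix with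
its transpose. For quadratic forms with `2 ≠ 0`, the polar form determines `Q`.

In characteristic two `h` preserves only the polar form. If that form is nondegenerate, `Q ∘ h - Q`
is the square of a functional `B z`, a Gauss sum shows that `Q z = s ^ 2 + s` for some `s`, and a
map along `z` commuting with `g` corrects `h`. If it has a radical line, a reversal on a complement
is lifted to the whole space. -/

namespace ClassicalReality

/-! ### Powers of a maximal principal ideal. -/

section PrincipalIdealRing

variable {A : Type*} [CommRing A]

/-- An element not divisible by `p` is a unit modulo every power of `p`; otherwise a factor `p` is
stripped and induction applies. -/
theorem pow_succ_dvd_or_exists_dvd_sub {p : A} (hp : (Ideal.span {p}).IsMaximal) (e : ℕ) (x : A) :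
    p ^ (e + 1) ∣ x ∨ ∃ c, p ^ (e + 1) ∣ c * x - p ^ e := by
  have key : ∀ x, p ∣ x ∨ IsCoprime x p := fun x => by
    by_cases h : p ∣ x
    · exact Or.inl h
    · right
      obtain ⟨y, i, hi, hy⟩ := hp.exists_inv (x := x) (by rwa [Ideal.mem_span_singleton])
      obtain ⟨z, rfl⟩ := Ideal.mem_span_singleton.1 hi
      exact ⟨y, z, by rw [← hy]; ring⟩
  induction e generalizing x with
  | zero =>
    rcases key x with h | ⟨a, b, h⟩
    · left; simpa using h
    · exact Or.inr ⟨a, -b, by linear_combination h⟩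
  | succ e ih =>
    rcases key x with ⟨y, rfl⟩ | h
    · rcases ih y with ⟨z, rfl⟩ | ⟨c, z, hz⟩
      · exact Or.inl ⟨z, by ring⟩
      · exact Or.inr ⟨c, z, by linear_combination p * hz⟩
    · obtain ⟨a, b, h⟩ := h.pow_right (n := e + 1 + 1)
      exact Or.inr ⟨p ^ (e + 1) * a, -b * p ^ (e + 1), by linear_combination p ^ (e + 1) * h⟩

/-- This is the tool for testing nondegeneracy: a nonzero vector of `A v` has a multiple equal to `p
^ e • v`, whose pairings are under control. -/
theorem exists_smul_eq_pow_smul {V : Type*} [AddCommGroup V] [Module A V] {p : A}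
    (hp : (Ideal.span {p}).IsMaximal) {e : ℕ} {v : V} (hv : p ^ (e + 1) • v = 0) {x : A}
    (hx : x • v ≠ 0) : ∃ c : A, (c * x) • v = p ^ e • v := by
  rcases pow_succ_dvd_or_exists_dvd_sub hp e x with ⟨y, rfl⟩ | ⟨c, d, h⟩
  · exact absurd (by rw [mul_comm, mul_smul, hv, smul_zero]) hx
  · refine ⟨c, ?_⟩
    rw [← sub_eq_zero, ← sub_smul, h, mul_comm, mul_smul, hv, smul_zero]

end PrincipalIdealRing

/-! ### Reversals on modules with one or two generators. -/

section Reversal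

variable {k A V : Type*} [Field k] [CommRing A] [Algebra k A] [AddCommGroup V] [Module k V]
  [Module A V] [IsScalarTower k A V] {B : LinearMap.BilinForm k V} {s : A →ₐ[k] A} {ε : k}

/-- The map is well defined: if `f x = 0`, then `g x` is orthogonal to the range of `g`, which is
everything. -/
theorem exists_linearMap_of_surjective {U : Type*} [AddCommGroup U] [Module k U]
    (hnd : ∀ x, (∀ y, B x y = 0) → x = 0) (f g : U →ₗ[k] V)
    (hf : Function.Surjective f) (hg : Function.Surjective g)
    (h : ∀ x y, B (g x) (g y) = B (f y) (f x)) : ∃ t : V →ₗ[k] V, ∀ x, t (f x) = g x := by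
  obtain ⟨i, hi⟩ := f.exists_rightInverse_of_surjective (LinearMap.range_eq_top.2 hf)
  refine ⟨g ∘ₗ i, fun x => ?_⟩
  have hfi : f (i (f x)) = f x := LinearMap.congr_fun hi (f x)
  rw [LinearMap.comp_apply, ← sub_eq_zero, ← map_sub]
  refine hnd _ fun y => ?_
  obtain ⟨z, rfl⟩ := hg y
  rw [h, map_sub, hfi, sub_self, map_zero]

/-- If the form `B` is nondegenerate, the ring `A` with involution `s` acts by adjoint pairs, and
`V` is cyclic over `A`, then there is an `s`-semilinear map reversing `B`. -/
theorem exists_reversal_of_cyclic (hs : ∀ a, s (s a) = a)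
    (hB : ∀ (a : A) x y, B (a • x) y = B x (s a • y)) (hnd : ∀ x, (∀ y, B x y = 0) → x = 0)
    (u : V) (hu : ∀ y : V, ∃ a : A, a • u = y) :
    ∃ h : V →ₗ[k] V, (∀ (a : A) x, h (a • x) = s a • h x) ∧ ∀ x y, B (h x) (h y) = B y x := by
  let f : A →ₗ[k] V := (LinearMap.toSpanSingleton A V u).restrictScalars k
  have hf : ∀ a, f a = a • u := fun a => rfl
  obtain ⟨h, hh⟩ := exists_linearMap_of_surjective (B := B) hnd f (f ∘ₗ s.toLinearMap) hu
    (fun y => by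
      obtain ⟨a, rfl⟩ := hu y
      exact ⟨s a, by simp [hf, hs]⟩)
    (fun x y => by
      simp only [LinearMap.comp_apply, AlgHom.toLinearMap_apply, hf, hB, hs, smul_smul]
      rw [mul_comm])
  have hh' : ∀ a : A, h (a • u) = s a • u := hh
  refine ⟨h, fun a x => ?_, fun x y => ?_⟩
  · obtain ⟨b, rfl⟩ := hu x
    rw [smul_smul, hh', hh', map_mul, mul_smul]
  · obtain ⟨a, rfl⟩ := hu x
    obtain ⟨b, rfl⟩ := hu y
    rw [hh', hh', hB, hB, hs, smul_smul, smul_smul, mul_comm]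

/-- The reversal is `a • v + b • w ↦ s a • v + s b • c • w`. The cross terms match precisely when `B
v ((c * x) • w) = ε * B v (s x • w)` for all `x`, and such a `c` is found by duality. -/
theorem exists_reversal_of_pair [FiniteDimensional k V] (hs : ∀ a, s (s a) = a)
    (hB : ∀ (a : A) x y, B (a • x) y = B x (s a • y)) (hε : ∀ x y, B x y = ε * B y x)
    (hεε : ε * ε = 1) (hnd : ∀ x, (∀ y, B x y = 0) → x = 0)
    {p μ : A} (hp : (Ideal.span {p}).IsMaximal) (hμ : s p = μ * p) {e : ℕ}
    (he : ∀ x : V, p ^ (e + 1) • x = 0) {v w : V} (hvw : B (p ^ e • v) w ≠ 0)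
    (hspan : ∀ y : V, ∃ a b : A, a • v + b • w = y) :
    ∃ h : V →ₗ[k] V, (∀ (a : A) x, h (a • x) = s a • h x) ∧ ∀ x y, B (h x) (h y) = B y x := by
  have hspe : ∀ n : ℕ, s (p ^ n) = μ ^ n * p ^ n := fun n => by rw [map_pow, hμ, mul_pow]
  -- If `p ^ (e + 1)` did not divide `x`, a multiple of `x` would act on `w` as `p ^ e`; moving `p ^
  -- e` across the form costs only the factor `μ ^ e`, and `hvw` is contradicted.
  have hann : ∀ x : A, (∀ y, B v ((y * x) • w) = 0) → p ^ (e + 1) ∣ x := fun x hx => by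
    refine (pow_succ_dvd_or_exists_dvd_sub hp e x).resolve_right ?_
    rintro ⟨c, d, h⟩
    apply hvw
    have h1 : (μ ^ e * c * x) • w = (μ ^ e * p ^ e) • w := by
      rw [← sub_eq_zero, ← sub_smul,
        show μ ^ e * c * x - μ ^ e * p ^ e = μ ^ e * d * p ^ (e + 1) by linear_combination μ ^ e * h,
        mul_smul, he, smul_zero]
    rw [hB, hspe, ← h1]
    exact hx _
  let L : V →ₗ[k] Module.Dual k A :=
    (LinearMap.lcomp k k ((LinearMap.toSpanSingleton A V w).restrictScalars k)) ∘ₗ B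
  have hL : ∀ z x, L z x = B z (x • w) := fun _ _ => rfl
  let Θ : A →ₗ[k] Module.Dual k A :=
    L ∘ₗ ((LinearMap.toSpanSingleton A V v).restrictScalars k ∘ₗ s.toLinearMap)
  have hΘ : ∀ c x, Θ c x = B v ((c * x) • w) := fun c x => by
    change B (s c • v) (x • w) = _
    rw [hB, hs, smul_smul]
  let χ : Module.Dual k A := ε • (L v ∘ₗ s.toLinearMap)
  have hχ : ∀ x, χ x = ε * B v (s x • w) := fun x => rfl
  -- `A` may be infinite-dimensional, but `Θ` factors through `V`, so its range is the annihilator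
  -- of its coannihilator.
  have hfd : FiniteDimensional k (LinearMap.range Θ) :=
    Submodule.finiteDimensional_of_le (LinearMap.range_comp_le_range _ L)
  have hχΘ : χ ∈ LinearMap.range Θ := by
    rw [← Subspace.dualCoannihilator_dualAnnihilator_eq (W := LinearMap.range Θ),
      Submodule.mem_dualAnnihilator]
    intro x hx
    rw [Submodule.mem_dualCoannihilator] at hx
    obtain ⟨d, rfl⟩ := hann x fun y => by rw [← hΘ]; exact hx _ ⟨y, rfl⟩
    rw [hχ, map_mul, hspe, mul_right_comm, mul_smul, he, smul_zero, map_zero, mul_zero]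
  obtain ⟨c, hc⟩ := hχΘ
  have hc : ∀ x, B v ((c * x) • w) = ε * B v (s x • w) := fun x => by rw [← hΘ, hc, hχ]
  -- Using the relation for `c` twice produces `ε * ε = 1`, so `c * s c - 1` lies in the kernel
  -- described by `hann`.
  have hcc : (c * s c) • w = w := by
    rw [← sub_eq_zero]
    nth_rewrite 2 [← one_smul A w]
    rw [← sub_smul]
    obtain ⟨d, hd⟩ := hann (c * s c - 1) fun y => by
      rw [show y * (c * s c - 1) = c * (s c * y) - y by ring, sub_smul, map_sub, hc, map_mul, hs,
        hc, hs, ← mul_assoc, hεε, one_mul, sub_self]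
    rw [hd, mul_comm, mul_smul, he, smul_zero]
  have hcc' : ∀ a : A, (a * (c * s c)) • w = a • w := fun a => by rw [mul_smul, hcc]
  let f : A × A →ₗ[k] V := LinearMap.coprod ((LinearMap.toSpanSingleton A V v).restrictScalars k)
    ((LinearMap.toSpanSingleton A V w).restrictScalars k)
  have hf : ∀ a b, f (a, b) = a • v + b • w := fun a b => rfl
  let g : A × A →ₗ[k] V := LinearMap.coprod
    ((LinearMap.toSpanSingleton A V v).restrictScalars k ∘ₗ s.toLinearMap)
    ((LinearMap.toSpanSingleton A V (c • w)).restrictScalars k ∘ₗ s.toLinearMap)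
  have hg : ∀ a b, g (a, b) = s a • v + s b • c • w := fun a b => rfl
  have hfg : ∀ x y, B (g x) (g y) = B (f y) (f x) := by
    rintro ⟨a, b⟩ ⟨a', b'⟩
    have h1 : B (s a • v) (s a' • v) = B (a' • v) (a • v) := by
      rw [hB, hB, hs, smul_smul, smul_smul, mul_comm]
    have h2 : B (s a • v) (s b' • c • w) = B (b' • w) (a • v) := by
      rw [hε (b' • w), hB, hB, hs, smul_smul, smul_smul, smul_smul,
        show a * s b' * c = c * (a * s b') by ring, hc, map_mul, hs]
    have h3 : B (s b • c • w) (s a' • v) = B (a' • v) (b • w) := by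
      rw [hε, hB, hB, hs, smul_smul, smul_smul, smul_smul,
        show a' * s b * c = c * (a' * s b) by ring, hc, map_mul, hs, ← mul_assoc, hεε, one_mul]
    have h4 : B (s b • c • w) (s b' • c • w) = B (b' • w) (b • w) := by
      rw [hB, hB, hB, hs, smul_smul, smul_smul, smul_smul, smul_smul, ← hcc' (s b' * b)]
      congr 2
      ring
    rw [hf, hf, hg, hg]
    simp only [map_add, LinearMap.add_apply, h1, h2, h3, h4]
    ring
  obtain ⟨h, hh⟩ := exists_linearMap_of_surjective (B := B) hnd f g
    (fun y => by
      obtain ⟨a, b, rfl⟩ := hspan y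
      exact ⟨(a, b), rfl⟩)
    (fun y => by
      obtain ⟨a, b, rfl⟩ := hspan y
      refine ⟨(s a, s (b * s c)), ?_⟩
      rw [hg, hs, hs, smul_smul, mul_assoc, mul_comm (s c), hcc']) hfg
  have hh' : ∀ a b : A, h (a • v + b • w) = s a • v + s b • c • w := fun a b => hh (a, b)
  refine ⟨h, fun a x => ?_, fun x y => ?_⟩
  · obtain ⟨b, b', rfl⟩ := hspan x
    rw [smul_add, smul_smul, smul_smul, hh', hh', smul_add, map_mul, map_mul, mul_smul, mul_smul]
  · obtain ⟨a, a', rfl⟩ := hspan x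
    obtain ⟨b, b', rfl⟩ := hspan y
    rw [hh', hh']
    exact hfg (a, a') (b, b')

end Reversal

/-! ### Orthogonal decomposition and the indecomposable case. -/

section Decomposition

variable {k A V : Type*} [Field k] [CommRing A] [Algebra k A] [AddCommGroup V] [Module k V]
  [Module A V] [IsScalarTower k A V] {B : LinearMap.BilinForm k V} {s : A →ₐ[k] A} {ε : k}

/-- The restriction of `B` to the submodule `W` is nondegenerate. -/
def IsNondegenerateOn (B : LinearMap.BilinForm k V) (W : Submodule A V) : Prop :=
  ∀ x ∈ W, (∀ y ∈ W, B x y = 0) → x = 0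

/-- The parts of `V` killed by powers of `p` and of `s p` are totally isotropic and dual to each
other. A `v` in the first and a `w` in the second with `B (p ^ e • v) w ≠ 0` make `A (v + w)`
nondegenerate, so `V` is cyclic. -/
theorem exists_reversal_of_coprime (hs : ∀ a, s (s a) = a)
    (hB : ∀ (a : A) x y, B (a • x) y = B x (s a • y)) (hε : ∀ x y, B x y = ε * B y x)
    (hnd : ∀ x, (∀ y, B x y = 0) → x = 0) [Nontrivial V]
    (hind : ∀ W : Submodule A V, IsNondegenerateOn B W → W = ⊥ ∨ W = ⊤)
    {p : A} (hp : (Ideal.span {p}).IsMaximal) (hcop : IsCoprime p (s p))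
    (hN : ∃ n : ℕ, ∀ x : V, (p * s p) ^ n • x = 0) :
    ∃ h : V →ₗ[k] V, (∀ (a : A) x, h (a • x) = s a • h x) ∧ ∀ x y, B (h x) (h y) = B y x := by
  classical
  have hnd' : ∀ x, (∀ y, B y x = 0) → x = 0 := fun x h => hnd x fun y => by rw [hε, h, mul_zero]
  have hp' : (Ideal.span {s p}).IsMaximal := by
    let σ : A ≃+* A := RingEquiv.ofRingHom (s : A →+* A) (s : A →+* A)
      (RingHom.ext hs) (RingHom.ext hs)
    have := Ideal.map_isMaximal_of_equiv σ (p := Ideal.span {p})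
    rwa [Ideal.map_span, Set.image_singleton] at this
  obtain ⟨e, he, hmin⟩ : ∃ e : ℕ, (∀ x : V, (p * s p) ^ (e + 1) • x = 0) ∧
      ¬ ∀ x : V, (p * s p) ^ e • x = 0 := by
    have h0 : Nat.find hN ≠ 0 := fun h => by
      obtain ⟨x, hx⟩ := exists_ne (0 : V)
      have := Nat.find_spec hN x
      rw [h, pow_zero, one_smul] at this
      exact hx this
    obtain ⟨e, he⟩ := Nat.exists_eq_succ_of_ne_zero h0
    exact ⟨e, by simpa only [he] using Nat.find_spec hN, Nat.find_min hN (by omega)⟩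
  -- The Bézout terms act as projections: `β * s p ^ (e + 1)` will fix `v` and kill `w`, and `α * p
  -- ^ (e + 1)` the reverse.
  obtain ⟨α, β, hαβ⟩ : IsCoprime (p ^ (e + 1)) (s p ^ (e + 1)) := hcop.pow
  have hkill : ∀ (a : A) (x : V), (a * (p ^ (e + 1) * s p ^ (e + 1))) • x = 0 := fun a x => by
    rw [mul_smul, ← mul_pow, he, smul_zero]
  obtain ⟨v, hv, hv'⟩ : ∃ v : V, p ^ (e + 1) • v = 0 ∧ p ^ e • v ≠ 0 := by
    -- Otherwise `p ^ e * s p ^ (e + 1)` kills `V`, hence so does its adjoint, and a Bézout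
    -- combination contradicts the minimality of `e`.
    by_contra! hcon
    have h1 : ∀ x : V, (p ^ e * s p ^ (e + 1)) • x = 0 := fun x => by
      rw [mul_smul]
      refine hcon _ ?_
      rw [smul_smul, ← one_mul (_ * _), hkill]
    have h2 : ∀ x : V, (s p ^ e * p ^ (e + 1)) • x = 0 := fun x => by
      refine hnd' _ fun y => ?_
      have := hB (p ^ e * s p ^ (e + 1)) y x
      rw [h1, map_mul, map_pow, map_pow, hs, map_zero, LinearMap.zero_apply] at this
      exact this.symm
    refine hmin fun x => ?_
    rw [show (p * s p) ^ e = α * p ^ e * (s p ^ e * p ^ (e + 1))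
      + β * s p ^ e * (p ^ e * s p ^ (e + 1)) by linear_combination (- (p * s p) ^ e) * hαβ,
      add_smul, mul_smul _ (s p ^ e * _), h2, mul_smul _ (p ^ e * _), h1, smul_zero, smul_zero,
      add_zero]
  obtain ⟨w, hw, hvw⟩ : ∃ w : V, s p ^ (e + 1) • w = 0 ∧ B (p ^ e • v) w ≠ 0 := by
    obtain ⟨w, hw⟩ : ∃ w, B (p ^ e • v) w ≠ 0 := by
      by_contra! h
      exact hv' (hnd _ h)
    refine ⟨(α * p ^ (e + 1)) • w, ?_, ?_⟩
    · rw [smul_smul, show s p ^ (e + 1) * (α * p ^ (e + 1)) = α * (p ^ (e + 1) * s p ^ (e + 1)) by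
        ring, hkill]
    · have h1 : w = (α * p ^ (e + 1)) • w + (β * s p ^ (e + 1)) • w := by
        rw [← add_smul, hαβ, one_smul]
      have h2 : B (p ^ e • v) ((β * s p ^ (e + 1)) • w) = 0 := by
        rw [show β * s p ^ (e + 1) = s (s β * p ^ (e + 1)) by rw [map_mul, hs, map_pow], ← hB,
          smul_smul, show s β * p ^ (e + 1) * p ^ e = s β * p ^ e * p ^ (e + 1) by ring,
          mul_smul, hv, smul_zero, map_zero, LinearMap.zero_apply]
      rw [h1, map_add, h2, add_zero] at hw
      exact hw
  have hpv : ∀ a : A, (a * (β * s p ^ (e + 1))) • v = a • v := fun a => by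
    rw [show a * (β * s p ^ (e + 1)) = a - a * α * p ^ (e + 1) by linear_combination a * hαβ,
      sub_smul, mul_smul _ (p ^ _), hv, smul_zero, sub_zero]
  have hpw : ∀ a : A, (a * (α * p ^ (e + 1))) • w = a • w := fun a => by
    rw [show a * (α * p ^ (e + 1)) = a - a * β * s p ^ (e + 1) by linear_combination a * hαβ,
      sub_smul, mul_smul _ (s p ^ _), hw, smul_zero, sub_zero]
  have hpw0 : ∀ a : A, (a * (β * s p ^ (e + 1))) • w = 0 := fun a => by
    rw [← mul_assoc, mul_smul, hw, smul_zero]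
  have hpv0 : ∀ a : A, (a * (α * p ^ (e + 1))) • v = 0 := fun a => by
    rw [← mul_assoc, mul_smul, hv, smul_zero]
  have hvv : ∀ a : A, B (a • v) v = 0 := fun a => by
    rw [← hpv a, mul_comm, mul_smul, hB, map_mul, map_pow, hs, mul_smul, hv, smul_zero, map_zero]
  have hww : ∀ a : A, B (a • w) w = 0 := fun a => by
    rw [← hpw a, mul_comm, mul_smul, hB, map_mul, map_pow, mul_smul, hw, smul_zero, map_zero]
  have hw' : B (s p ^ e • w) v ≠ 0 := by
    rw [hε, ← map_pow, ← hB]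
    exact mul_ne_zero (left_ne_zero_of_mul (hε _ _ ▸ hvw)) hvw
  have hW : IsNondegenerateOn B (Submodule.span A {v + w}) := by
    intro x hx hrad
    obtain ⟨a, rfl⟩ := Submodule.mem_span_singleton.1 hx
    have hr : ∀ c b : A, B ((c * a) • (v + w)) (b • (v + w)) = 0 := fun c b => by
      rw [mul_smul, hB, smul_smul]
      exact hrad _ (Submodule.smul_mem _ _ (Submodule.mem_span_singleton_self _))
    have hav : a • v = 0 := by
      by_contra hav
      obtain ⟨c, hc⟩ := exists_smul_eq_pow_smul hp hv hav
      apply hvw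
      have := hr (β * s p ^ (e + 1) * c) 1
      rw [show β * s p ^ (e + 1) * c * a = c * a * (β * s p ^ (e + 1)) by ring, smul_add, hpv,
        hpw0, add_zero, one_smul, hc, map_add, hvv, zero_add] at this
      exact this
    have haw : a • w = 0 := by
      by_contra haw
      obtain ⟨c, hc⟩ := exists_smul_eq_pow_smul hp' hw haw
      apply hw'
      have := hr (α * p ^ (e + 1) * c) 1
      rw [show α * p ^ (e + 1) * c * a = c * a * (α * p ^ (e + 1)) by ring, smul_add, hpw,
        hpv0, zero_add, one_smul, hc, map_add, hww, add_zero] at this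
      exact this
    rw [smul_add, hav, haw, add_zero]
  have htop : Submodule.span A {v + w} = ⊤ := by
    refine (hind _ hW).resolve_left fun h => hvw ?_
    rw [Submodule.span_singleton_eq_bot] at h
    have h3 := hvv (p ^ e)
    rw [eq_neg_of_add_eq_zero_right h, map_neg, h3, neg_zero]
  exact exists_reversal_of_cyclic hs hB hnd (v + w) fun y =>
    Submodule.mem_span_singleton.1 (htop ▸ Submodule.mem_top)

/-- If some `p ^ e • v` pairs nontrivially with `A v`, then `A v` is nondegenerate and fills `V`. If
this never happens, two vectors with `B (p ^ e • v) w ≠ 0` span a nondegenerate submodule. -/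
theorem exists_reversal_of_dvd [FiniteDimensional k V] (hs : ∀ a, s (s a) = a)
    (hB : ∀ (a : A) x y, B (a • x) y = B x (s a • y)) (hε : ∀ x y, B x y = ε * B y x)
    (hεε : ε * ε = 1) (hnd : ∀ x, (∀ y, B x y = 0) → x = 0) [Nontrivial V]
    (hind : ∀ W : Submodule A V, IsNondegenerateOn B W → W = ⊥ ∨ W = ⊤)
    {p : A} (hp : (Ideal.span {p}).IsMaximal) (hdvd : p ∣ s p)
    (hN : ∃ n : ℕ, ∀ x : V, (p * s p) ^ n • x = 0) :
    ∃ h : V →ₗ[k] V, (∀ (a : A) x, h (a • x) = s a • h x) ∧ ∀ x y, B (h x) (h y) = B y x := by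
  classical
  obtain ⟨μ, hμ⟩ := hdvd
  rw [mul_comm] at hμ
  have hN' : ∃ n : ℕ, ∀ x : V, p ^ n • x = 0 := by
    obtain ⟨n, hn⟩ := hN
    refine ⟨2 * n, fun x => ?_⟩
    have : p = s μ * s p := by rw [← map_mul, ← hμ, hs]
    rw [show p ^ (2 * n) = s μ ^ n * (p * s p) ^ n by
      rw [← mul_pow, mul_left_comm, ← this, pow_mul, sq], mul_smul, hn, smul_zero]
  obtain ⟨e, he, hmin⟩ : ∃ e : ℕ, (∀ x : V, p ^ (e + 1) • x = 0) ∧ ¬ ∀ x : V, p ^ e • x = 0 := by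
    have h0 : Nat.find hN' ≠ 0 := fun h => by
      obtain ⟨x, hx⟩ := exists_ne (0 : V)
      have := Nat.find_spec hN' x
      rw [h, pow_zero, one_smul] at this
      exact hx this
    obtain ⟨e, he⟩ := Nat.exists_eq_succ_of_ne_zero h0
    exact ⟨e, by simpa only [he] using Nat.find_spec hN', Nat.find_min hN' (by omega)⟩
  by_cases hz : ∀ (v : V) (a : A), B (p ^ e • v) (a • v) = 0
  · obtain ⟨v, hv⟩ := not_forall.1 hmin
    obtain ⟨w, hvw⟩ : ∃ w, B (p ^ e • v) w ≠ 0 := by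
      by_contra! h
      exact hv (hnd _ h)
    have hwv : B (p ^ e • w) ((s μ ^ e) • v) ≠ 0 := by
      rw [hε, hB, map_pow, hs, smul_smul, ← mul_pow, ← hμ, ← map_pow, ← hB]
      exact mul_ne_zero (left_ne_zero_of_mul (hε _ _ ▸ hvw)) hvw
    have hW : IsNondegenerateOn B (Submodule.span A {v, w}) := by
      intro x hx hrad
      obtain ⟨a, b, rfl⟩ := Submodule.mem_span_pair.1 hx
      have hr : ∀ (c d d' : A), B (c • (a • v + b • w)) (d • v + d' • w) = 0 := fun c d d' => by
        rw [hB]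
        exact hrad _ (Submodule.smul_mem _ _ (Submodule.mem_span_pair.2 ⟨d, d', rfl⟩))
      have hbw : b • w = 0 := by
        by_contra hbw
        by_cases hav : a • v = 0
        · obtain ⟨c, hc⟩ := exists_smul_eq_pow_smul hp (he w) hbw
          apply hwv
          have := hr c (s μ ^ e) 0
          rwa [hav, zero_add, smul_smul, hc, zero_smul, add_zero] at this
        obtain ⟨c, hc⟩ := exists_smul_eq_pow_smul hp (he v) hav
        by_cases hcb : (c * b) • w = 0
        · apply hvw
          have := hr c 0 1
          rwa [smul_add, smul_smul, smul_smul, hcb, hc, add_zero, zero_smul, zero_add,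
            one_smul] at this
        -- After multiplying by `c' * c` the `v`-component is a multiple of `p ^ e • v`, which `hz`
        -- makes orthogonal to `A v`, so only `p ^ e • w` contributes.
        · obtain ⟨c', hc'⟩ := exists_smul_eq_pow_smul hp (he w) hcb
          apply hwv
          have := hr (c' * c) (s μ ^ e) 0
          rw [smul_add, mul_smul, mul_smul, smul_smul c, smul_smul c, hc, smul_smul c',
            smul_smul c', hc', zero_smul, add_zero, map_add, LinearMap.add_apply, mul_smul c',
            hB c', smul_smul, hz, zero_add] at this
          exact this
      have hav : a • v = 0 := by
        by_contra hav
        obtain ⟨c, hc⟩ := exists_smul_eq_pow_smul hp (he v) hav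
        apply hvw
        have := hr c 0 1
        rwa [hbw, add_zero, smul_smul, hc, zero_smul, zero_add, one_smul] at this
      rw [hav, hbw, add_zero]
    have htop : Submodule.span A {v, w} = ⊤ := by
      refine (hind _ hW).resolve_left fun h => hv ?_
      have : v ∈ Submodule.span A {v, w} := Submodule.subset_span (by simp)
      rw [h, Submodule.mem_bot] at this
      rw [this, smul_zero]
    exact exists_reversal_of_pair hs hB hε hεε hnd hp hμ he hvw fun y =>
      Submodule.mem_span_pair.1 (htop ▸ Submodule.mem_top)
  · push Not at hz
    obtain ⟨v, t, hvt⟩ := hz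
    have hW : IsNondegenerateOn B (Submodule.span A {v}) := by
      intro x hx hrad
      obtain ⟨a, rfl⟩ := Submodule.mem_span_singleton.1 hx
      by_contra hav
      obtain ⟨c, hc⟩ := exists_smul_eq_pow_smul hp (he v) hav
      apply hvt
      rw [← hc, mul_smul, hB, smul_smul]
      exact hrad _ (Submodule.smul_mem _ _ (Submodule.mem_span_singleton_self _))
    have htop : Submodule.span A {v} = ⊤ := by
      refine (hind _ hW).resolve_left fun h => hvt ?_
      rw [Submodule.span_singleton_eq_bot.1 h]
      simp
    exact exists_reversal_of_cyclic hs hB hnd v fun y =>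
      Submodule.mem_span_singleton.1 (htop ▸ Submodule.mem_top)

/-- Take `p` generating the annihilator of a simple submodule. Multiplication by `p * s p` is
self-adjoint, so the range in its Fitting decomposition is nondegenerate; it cannot be everything
because `p` kills the simple submodule, hence `p * s p` is nilpotent on `V`. -/
theorem exists_reversal_of_indecomposable [FiniteDimensional k V] [IsPrincipalIdealRing A]
    (hs : ∀ a, s (s a) = a)
    (hB : ∀ (a : A) x y, B (a • x) y = B x (s a • y)) (hε : ∀ x y, B x y = ε * B y x)
    (hεε : ε * ε = 1) (hnd : ∀ x, (∀ y, B x y = 0) → x = 0) [Nontrivial V]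
    (hind : ∀ W : Submodule A V, IsNondegenerateOn B W → W = ⊥ ∨ W = ⊤) :
    ∃ h : V →ₗ[k] V, (∀ (a : A) x, h (a • x) = s a • h x) ∧ ∀ x y, B (h x) (h y) = B y x := by
  have : IsNoetherian A V := isNoetherian_of_tower k inferInstance
  have : IsArtinian A V := isArtinian_of_tower k inferInstance
  obtain ⟨S, hS, -⟩ := (eq_bot_or_exists_atom_le (⊤ : Submodule A V)).resolve_left top_ne_bot
  have : IsSimpleModule A S := isSimpleModule_iff_isAtom.2 hS
  have hmax := IsSimpleModule.annihilator_isMaximal (R := A) (M := S)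
  obtain ⟨p, hp⟩ := (IsPrincipalIdealRing.principal (Module.annihilator A S)).principal
  have hpS : ∀ x ∈ S, p • x = 0 := fun x hx => by
    have : p ∈ Module.annihilator A S := hp ▸ Ideal.mem_span_singleton_self p
    exact congrArg Subtype.val (Module.mem_annihilator.1 this ⟨x, hx⟩)
  rw [hp] at hmax
  have hN : ∃ n : ℕ, ∀ x : V, (p * s p) ^ n • x = 0 := by
    let T : Module.End A V := LinearMap.lsmul A V (p * s p)
    have hT : ∀ (n : ℕ) x, (T ^ n) x = (p * s p) ^ n • x := fun n x => by
      induction n generalizing x with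
      | zero => rw [pow_zero, pow_zero, one_smul, Module.End.one_apply]
      | succ n ih =>
        rw [pow_succ, Module.End.mul_apply, ih, pow_succ, mul_smul]
        rfl
    have hsT : ∀ n : ℕ, s ((p * s p) ^ n) = (p * s p) ^ n := fun n => by
      rw [map_pow, map_mul, hs, mul_comm]
    obtain ⟨n, hn, hn1⟩ := (T.eventually_isCompl_ker_pow_range_pow.and
      (Filter.eventually_ge_atTop 1)).exists
    refine ⟨n, fun x => ?_⟩
    have hW : IsNondegenerateOn B (LinearMap.range (T ^ n)) := by
      rintro _ ⟨x, rfl⟩ hrad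
      have h1 : (T ^ n) ((T ^ n) x) = 0 := by
        refine hnd _ fun y => ?_
        rw [hT n (_), hB, hsT, ← hT]
        exact hrad _ ⟨y, rfl⟩
      exact Submodule.disjoint_def.1 hn.disjoint _ h1 ⟨x, rfl⟩
    rcases hind _ hW with h | h
    · rw [← hT]
      exact (Submodule.mem_bot A).1 (h ▸ ⟨x, rfl⟩)
    · exfalso
      have hk : LinearMap.ker (T ^ n) = ⊥ := by
        have := hn.disjoint
        rwa [h, disjoint_top] at this
      obtain ⟨y, hy, hy0⟩ := Submodule.exists_mem_ne_zero_of_ne_bot hS.1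
      apply hy0
      rw [← Submodule.mem_bot A, ← hk, LinearMap.mem_ker, hT]
      obtain ⟨m, rfl⟩ := Nat.exists_eq_add_of_le hn1
      rw [show (p * s p) ^ (1 + m) = (p * s p) ^ m * s p * p by ring, mul_smul, hpS y hy, smul_zero]
  by_cases hdvd : p ∣ s p
  · exact exists_reversal_of_dvd hs hB hε hεε hnd hind hmax hdvd hN
  · refine exists_reversal_of_coprime hs hB hε hnd hind hmax ?_ hN
    obtain ⟨y, i, hi, hy⟩ := hmax.exists_inv (x := s p) (by rwa [Ideal.mem_span_singleton])
    obtain ⟨z, rfl⟩ := Ideal.mem_span_singleton.1 hi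
    exact ⟨z, y, by rw [← hy]; ring⟩

theorem exists_reversal_of_isCompl (hε : ∀ x y, B x y = ε * B y x)
    {W W' : Submodule A V} (hW : IsCompl W W') (horth : ∀ x ∈ W, ∀ y ∈ W', B x y = 0)
    {f : W →ₗ[k] W} (hf : ∀ (a : A) x, f (a • x) = s a • f x)
    (hfB : ∀ x y, B (f x) (f y) = B y x)
    {g : W' →ₗ[k] W'} (hg : ∀ (a : A) x, g (a • x) = s a • g x)
    (hgB : ∀ x y, B (g x) (g y) = B y x) :
    ∃ h : V →ₗ[k] V, (∀ (a : A) x, h (a • x) = s a • h x) ∧ ∀ x y, B (h x) (h y) = B y x := by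
  have horth' : ∀ x ∈ W', ∀ y ∈ W, B x y = 0 := fun x hx y hy => by
    rw [hε, horth y hy x hx, mul_zero]
  have hc : IsCompl (W.restrictScalars k) (W'.restrictScalars k) := by
    rw [isCompl_iff, disjoint_iff, codisjoint_iff] at hW ⊢
    constructor
    · ext x
      exact SetLike.ext_iff.1 hW.1 x
    · rw [← Submodule.restrictScalars_sup, hW.2, Submodule.restrictScalars_top]
  let h := LinearMap.ofIsCompl hc ((W.subtype.restrictScalars k) ∘ₗ f)
    ((W'.subtype.restrictScalars k) ∘ₗ g)
  have hh : ∀ (x : W) (y : W'), h (x + y) = f x + g y := fun x y => by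
    rw [map_add]
    congr 1
    · exact LinearMap.ofIsCompl_apply_left hc x
    · exact LinearMap.ofIsCompl_apply_right hc y
  have hdec : ∀ z : V, ∃ (x : W) (y : W'), (x : V) + y = z := fun z => by
    have : z ∈ W ⊔ W' := hW.sup_eq_top ▸ Submodule.mem_top
    obtain ⟨x, hx, y, hy, rfl⟩ := Submodule.mem_sup.1 this
    exact ⟨⟨x, hx⟩, ⟨y, hy⟩, rfl⟩
  refine ⟨h, fun a z => ?_, fun z z' => ?_⟩
  · obtain ⟨x, y, rfl⟩ := hdec z
    rw [smul_add, ← Submodule.coe_smul, ← Submodule.coe_smul, hh, hh, hf, hg, smul_add,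
      Submodule.coe_smul, Submodule.coe_smul]
  · obtain ⟨x, y, rfl⟩ := hdec z
    obtain ⟨x', y', rfl⟩ := hdec z'
    rw [hh, hh]
    simp only [map_add, LinearMap.add_apply, hfB, hgB, horth _ (f x).2 _ (g y').2,
      horth' _ (g y).2 _ (f x').2, horth _ x'.2 _ y.2, horth' _ y'.2 _ x.2]

/-- Let `A` be a commutative principal ideal algebra with involution `s`, acting on a
finite-dimensional space `V` so that `a` and `s a` are adjoint with respect to a nondegenerate
(skew-)symmetric form `B`. Then some `s`-semilinear map carries `B` to the transposed form. -/
theorem exists_reversal [IsPrincipalIdealRing A] (hs : ∀ a, s (s a) = a) (hεε : ε * ε = 1)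
    (d : ℕ) : ∀ (V : Type*) [AddCommGroup V] [Module k V] [Module A V] [IsScalarTower k A V]
      [FiniteDimensional k V] (B : LinearMap.BilinForm k V),
      Module.finrank k V = d → (∀ (a : A) x y, B (a • x) y = B x (s a • y)) →
      (∀ x y, B x y = ε * B y x) → (∀ x, (∀ y, B x y = 0) → x = 0) →
    ∃ h : V →ₗ[k] V, (∀ (a : A) x, h (a • x) = s a • h x) ∧ ∀ x y, B (h x) (h y) = B y x := by
  induction d using Nat.strong_induction_on with
  | _ d ih =>
  intro V _ _ _ _ _ B hd hB hε hnd
  rcases subsingleton_or_nontrivial V with hV | hV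
  · refine ⟨0, fun a x => by simp, fun x y => ?_⟩
    rw [Subsingleton.elim x 0, Subsingleton.elim y 0]
    simp
  by_cases hind : ∀ W : Submodule A V, IsNondegenerateOn B W → W = ⊥ ∨ W = ⊤
  · exact exists_reversal_of_indecomposable hs hB hε hεε hnd hind
  push Not at hind
  obtain ⟨W, hW, hbot, htop⟩ := hind
  let W' : Submodule A V :=
    { carrier := {x | ∀ y ∈ W, B y x = 0}
      add_mem' := fun {x x'} hx hx' y hy => by rw [map_add, hx y hy, hx' y hy, add_zero]
      zero_mem' := fun y hy => map_zero _
      smul_mem' := fun a x hx y hy => by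
        rw [← hs a, ← hB]
        exact hx _ (W.smul_mem _ hy) }
  have horth : ∀ x ∈ W, ∀ y ∈ W', B x y = 0 := fun x hx y hy => hy x hx
  have hc : IsCompl W W' := by
    have hrefl : B.IsRefl := fun x y h => by rw [hε, h, mul_zero]
    have h1 : IsCompl (W.restrictScalars k) (B.orthogonal (W.restrictScalars k)) := by
      rw [LinearMap.BilinForm.isCompl_orthogonal_iff_disjoint hrefl, Submodule.disjoint_def]
      intro x hx hx'
      exact hW x hx fun y hy => hrefl _ _ (hx' y hy)
    rw [isCompl_iff, Submodule.disjoint_def, codisjoint_iff, eq_top_iff]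
    refine ⟨fun x hx hx' => Submodule.disjoint_def.1 h1.disjoint x hx hx', fun x _ => ?_⟩
    have : x ∈ W.restrictScalars k ⊔ B.orthogonal (W.restrictScalars k) :=
      h1.sup_eq_top ▸ Submodule.mem_top
    obtain ⟨y, hy, z, hz, rfl⟩ := Submodule.mem_sup.1 this
    exact Submodule.add_mem_sup hy hz
  have hlt : ∀ U : Submodule A V, U ≠ ⊤ → Module.finrank k U < d := fun U hU => by
    rw [← hd]
    refine Submodule.finrank_lt (s := U.restrictScalars k) ?_
    rwa [ne_eq, Submodule.restrictScalars_eq_top_iff]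
  have hW' : IsNondegenerateOn B W' := fun x hx hrad => hnd x fun y => by
    have : y ∈ W ⊔ W' := hc.sup_eq_top ▸ Submodule.mem_top
    obtain ⟨z, hz, z', hz', rfl⟩ := Submodule.mem_sup.1 this
    rw [map_add, hrad z' hz', hε, horth z hz x hx, mul_zero, add_zero]
  have key : ∀ U : Submodule A V, U ≠ ⊤ → IsNondegenerateOn B U → ∃ h : U →ₗ[k] U,
      (∀ (a : A) x, h (a • x) = s a • h x) ∧ ∀ x y, B (h x) (h y) = B y x := fun U hU hUB => by
    have : FiniteDimensional k U := inferInstanceAs (FiniteDimensional k (U.restrictScalars k))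
    have : IsScalarTower k A U := ⟨fun a b x => Subtype.ext (smul_assoc a b (x : V))⟩
    have key := ih _ (hlt U hU) U
    exact key (B.restrict (U.restrictScalars k)) rfl (fun a x y => hB a x y)
      (fun x y => hε x y)
      (fun x hx => Subtype.ext (hUB x x.2 fun y hy => hx ⟨y, hy⟩))
  obtain ⟨f, hf, hfB⟩ := key W htop hW
  obtain ⟨g, hg, hgB⟩ := key W' (fun h => hbot (by
    rw [eq_bot_iff, ← hc.inf_eq_bot, h, inf_top_eq])) hW'
  exact exists_reversal_of_isCompl hε hc horth hf hfB hg hgB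

end Decomposition

theorem injective_of_reversal {k V : Type*} [Field k] [AddCommGroup V] [Module k V]
    {B : LinearMap.BilinForm k V} {ε : k} (hε : ∀ x y, B x y = ε * B y x)
    (hnd : ∀ x, (∀ y, B x y = 0) → x = 0) {h : V →ₗ[k] V} (hh : ∀ x y, B (h x) (h y) = B y x) :
    Function.Injective h := by
  rw [injective_iff_map_eq_zero]
  intro x hx
  refine hnd x fun y => ?_
  rw [hε, ← hh, hx, map_zero, LinearMap.zero_apply, mul_zero]

/-! ### Isometries as modules over Laurent polynomials. -/

section Isometry

open LaurentPolynomial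

instance isPrincipalIdealRing_laurentPolynomial (K : Type*) [Field K] :
    IsPrincipalIdealRing K[T;T⁻¹] := by
  refine ⟨fun I => ?_⟩
  rw [← IsLocalization.map_under (Submonoid.powers (Polynomial.X : Polynomial K)) K[T;T⁻¹] I,
    ← Ideal.span_singleton_generator (I.under (Polynomial K)), Ideal.map_span,
    Set.image_singleton]
  exact ⟨_, rfl⟩

/-- The involution applies `σ` to coefficients and inverts `T`; it gives adjoints because the
adjoint of an isometry is its inverse. Keeping `B` bilinear over the smaller field `F` allows trace
forms of Hermitian forms. -/
theorem exists_reversal_of_isometry {F K V : Type*} [Field F] [Field K] [Algebra F K]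
    [AddCommGroup V] [Module F V] [Module K V] [IsScalarTower F K V] [FiniteDimensional F V]
    {σ : K →ₐ[F] K} (hσ : ∀ a, σ (σ a) = a) {B : LinearMap.BilinForm F V} {ε : F}
    (hεε : ε * ε = 1) (hBσ : ∀ (a : K) x y, B (a • x) y = B x (σ a • y))
    (hε : ∀ x y, B x y = ε * B y x) (hnd : ∀ x, (∀ y, B x y = 0) → x = 0)
    (g : (Module.End K V)ˣ) (hg : ∀ x y, B (g.1 x) (g.1 y) = B x y) :
    ∃ h : V →ₗ[F] V, (∀ (a : K) x, h (a • x) = σ a • h x) ∧ (∀ x, h (g.1 x) = g⁻¹.1 (h x)) ∧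
      ∀ x y, B (h x) (h y) = B y x := by
  let ρ : K[T;T⁻¹] →ₐ[K] Module.End K V :=
    AddMonoidAlgebra.lift K (Module.End K V) ℤ ((Units.coeHom _).comp (zpowersHom _ g))
  let : Module K[T;T⁻¹] V := Module.compHom V ρ.toRingHom
  have hsmul : ∀ (a : K[T;T⁻¹]) (x : V), a • x = ρ a x := fun _ _ => rfl
  have hCT : ∀ (n : ℤ) (c : K) (x : V), (C c * T n) • x = c • (g ^ n).1 x := fun n c x => by
    rw [hsmul, ← single_eq_C_mul_T]
    change AddMonoidAlgebra.lift K (Module.End K V) ℤ _ (AddMonoidAlgebra.single n c) x = _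
    rw [AddMonoidAlgebra.lift_single]
    rfl
  have : IsScalarTower F K[T;T⁻¹] V := ⟨fun c a x => by
    rw [hsmul, hsmul, ← algebraMap_smul K c a, map_smul, LinearMap.smul_apply, algebraMap_smul]⟩
  let s : K[T;T⁻¹] →ₐ[F] K[T;T⁻¹] :=
    (AddMonoidAlgebra.mapAlgHom ℤ σ).comp (invert.toAlgHom.restrictScalars F)
  have hsCT : ∀ (n : ℤ) (c : K), s (C c * T n) = C (σ c) * T (-n) := fun n c => by
    change AddMonoidAlgebra.mapAlgHom ℤ σ (invert (C c * T n)) = _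
    rw [map_mul, invert_C, invert_T, ← single_eq_C_mul_T, ← single_eq_C_mul_T]
    exact AddMonoidAlgebra.mapAlgHom_single _ _ _
  have hgn : ∀ (n : ℕ) x y, B ((g ^ n).1 x) ((g ^ n).1 y) = B x y := fun n => by
    induction n with
    | zero => exact fun x y => rfl
    | succ n ih =>
      intro x y
      rw [pow_succ', Units.val_mul, Module.End.mul_apply, Module.End.mul_apply, hg, ih]
  have hinv : ∀ (u : (Module.End K V)ˣ) x, u.1 (u⁻¹.1 x) = x := fun u x => by
    rw [← Module.End.mul_apply, ← Units.val_mul, mul_inv_cancel]; rfl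
  have hgz : ∀ (n : ℤ) x y, B ((g ^ n).1 x) y = B x ((g ^ (-n)).1 y) := fun n x y => by
    obtain ⟨m, rfl | rfl⟩ := n.eq_nat_or_neg
    · rw [zpow_neg, zpow_natCast, ← hgn m x, hinv]
    · rw [neg_neg, zpow_neg, zpow_natCast, ← hgn m _ y, hinv]
  obtain ⟨h, hh, hhB⟩ := exists_reversal (s := s) (ε := ε) (fun a => by
      induction a using LaurentPolynomial.induction_on' with
      | add p q hp hq => rw [map_add, map_add, hp, hq]
      | C_mul_T n c => rw [hsCT, hsCT, hσ, neg_neg]) hεε (Module.finrank F V) V B rfl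
    (fun a => by
      induction a using LaurentPolynomial.induction_on' with
      | add p q hp hq =>
        intro x y
        rw [add_smul, map_add, map_add, LinearMap.add_apply, hp, hq, add_smul, map_add]
      | C_mul_T n c =>
        intro x y
        rw [hsCT, hCT, hCT, hBσ, hgz, map_smul]) hε hnd
  refine ⟨h, fun a x => ?_, fun x => ?_, hhB⟩
  · have h0 : ∀ (c : K) x, (C c : K[T;T⁻¹]) • x = c • x := fun c x => by
      rw [← mul_one (C c), ← T_zero, hCT, zpow_zero]; rfl
    have h1 := hh (C a) x
    have h2 := hsCT 0 a
    rw [neg_zero, T_zero, mul_one, mul_one] at h2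
    rwa [h2, h0, h0] at h1
  · have h1 := hh (C 1 * T 1) x
    rwa [hsCT, hCT, hCT, map_one, one_smul, one_smul, zpow_neg, zpow_one] at h1

theorem exists_linearEquiv_reversal {F V : Type*} [Field F] [AddCommGroup V] [Module F V]
    [FiniteDimensional F V] {B : LinearMap.BilinForm F V} {ε : F}
    (hεε : ε * ε = 1) (hε : ∀ x y, B x y = ε * B y x) (hnd : ∀ x, (∀ y, B x y = 0) → x = 0)
    (g : V ≃ₗ[F] V) (hg : ∀ x y, B (g x) (g y) = B x y) :
    ∃ h : V ≃ₗ[F] V, h * g * h⁻¹ = g⁻¹ ∧ ∀ x y, B (h x) (h y) = B y x := by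
  obtain ⟨h, -, hgh, hB⟩ := exists_reversal_of_isometry (σ := AlgHom.id F F) (fun _ => rfl) hεε
    (fun a x y => by rw [map_smul, map_smul, LinearMap.smul_apply]; rfl) hε hnd
    ((LinearMap.GeneralLinearGroup.generalLinearEquiv F V).symm g) hg
  let e := LinearEquiv.ofInjectiveEndo h (injective_of_reversal hε hnd hB)
  refine ⟨e, ?_, hB⟩
  rw [mul_inv_eq_iff_eq_mul]
  exact LinearEquiv.ext hgh

end Isometry

theorem exists_mem_CSp_conj_eq_inv {F V : Type*} [Field F] [AddCommGroup V] [Module F V]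
    [FiniteDimensional F V] {B : LinearMap.BilinForm F V} (hB : B.IsAlt) (hnd : B.Nondegenerate)
    {g : V ≃ₗ[F] V} (hg : g ∈ Sp B) : ∃ h ∈ CSp B, h * g * h⁻¹ = g⁻¹ := by
  have hneg : ∀ x y, B x y = -1 * B y x := fun x y => by
    rw [neg_one_mul, LinearMap.BilinForm.IsAlt.neg_eq hB]
  obtain ⟨h, hh, hhB⟩ := exists_linearEquiv_reversal (by ring) hneg hnd.1 g hg
  exact ⟨h, ⟨-1, fun v w => by rw [hhB, hneg]; simp⟩, hh⟩

/-! ### General linear and unitary groups. -/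

section Matrices

/-- In the extension `α` is conjugation by an element, so `P` times that element is the conjugator.
-/
theorem isConj_inl_of_mul_apply {G : Type*} [Group G] {α : MulAut G} {x y : G} (P : G)
    (h : P * α x * P⁻¹ = y) :
    IsConj (SemidirectProduct.inl x : ExtByAut G α) (SemidirectProduct.inl y) := by
  let a : Subgroup.zpowers α := ⟨α, Subgroup.mem_zpowers α⟩
  refine isConj_iff.2 ⟨SemidirectProduct.inl P * SemidirectProduct.inr a, ?_⟩
  have h1 : (SemidirectProduct.inl (α x) : ExtByAut G α) =
      SemidirectProduct.inr a * SemidirectProduct.inl x * SemidirectProduct.inr a⁻¹ :=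
    SemidirectProduct.inl_aut (φ := (Subgroup.zpowers α).subtype) a x
  rw [← h, map_mul, map_mul, h1, map_inv, map_inv]
  group

open Polynomial in
/-- Every square matrix over a field is similar to its transpose. -/
theorem exists_mul_eq_transpose_mul {F : Type*} [Field F] {n : ℕ}
    (M : Matrix (Fin n) (Fin n) F) : ∃ P : GL (Fin n) F, P.1 * M = Mᵀ * P.1 := by
  -- The two factors act on two copies of `F^n` through `M` and `Mᵀ`. For the form pairing the
  -- copies by the dot product, swapping the factors is the adjoint involution.
  let ρ : F[X] × F[X] →ₐ[F] Module.End F ((Fin n → F) × (Fin n → F)) :=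
    (LinearMap.prodMapAlgHom F (Fin n → F) (Fin n → F)).comp
    (((aeval (Matrix.toLin' M)).comp (AlgHom.fst F F[X] F[X])).prod
      ((aeval (Matrix.toLin' Mᵀ)).comp (AlgHom.snd F F[X] F[X])))
  let : Module (F[X] × F[X]) ((Fin n → F) × (Fin n → F)) := Module.compHom _ ρ.toRingHom
  have hsmul : ∀ (p q : F[X]) (x y : Fin n → F), ((p, q) : F[X] × F[X]) • (x, y) =
    (aeval (Matrix.toLin' M) p x, aeval (Matrix.toLin' Mᵀ) q y) := fun p q x y => rfl
  have hsmul' : ∀ (a : F[X] × F[X]) (x : (Fin n → F) × (Fin n → F)), a • x = ρ a x := fun _ _ => rfl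
  have : IsScalarTower F (F[X] × F[X]) ((Fin n → F) × (Fin n → F)) := ⟨fun c a x => by
    rw [hsmul', hsmul', map_smul, LinearMap.smul_apply]⟩
  let s : F[X] × F[X] →ₐ[F] F[X] × F[X] := (AlgHom.snd F F[X] F[X]).prod (AlgHom.fst F F[X] F[X])
  let B : LinearMap.BilinForm F ((Fin n → F) × (Fin n → F)) :=
    LinearMap.mk₂ F (fun x y => x.1 ⬝ᵥ y.2 + x.2 ⬝ᵥ y.1)
    (fun x x' y => by simp only [Prod.fst_add, Prod.snd_add, add_dotProduct]; ring)
    (fun c x y => by simp only [Prod.smul_fst, Prod.smul_snd, smul_dotProduct, smul_add])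
    (fun x y y' => by simp only [Prod.fst_add, Prod.snd_add, dotProduct_add]; ring)
    (fun c x y => by simp only [Prod.smul_fst, Prod.smul_snd, dotProduct_smul, smul_add])
  have hB : ∀ x y : (Fin n → F) × (Fin n → F), B x y = x.1 ⬝ᵥ y.2 + x.2 ⬝ᵥ y.1 := fun _ _ => rfl
  have hadj : ∀ (N : Matrix (Fin n) (Fin n) F) (p : F[X]) (x y : Fin n → F),
      aeval (Matrix.toLin' N) p x ⬝ᵥ y = x ⬝ᵥ aeval (Matrix.toLin' Nᵀ) p y := fun N p => by
    induction p using Polynomial.induction_on' with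
    | add p q hp hq =>
      intro x y
      rw [map_add, map_add, LinearMap.add_apply, LinearMap.add_apply, add_dotProduct,
        dotProduct_add, hp, hq]
    | monomial m a =>
      have hm : ∀ (m : ℕ) (x y : Fin n → F), ((Matrix.toLin' N) ^ m) x ⬝ᵥ y =
          x ⬝ᵥ ((Matrix.toLin' Nᵀ) ^ m) y := fun m => by
        induction m with
        | zero => exact fun _ _ => rfl
        | succ m ih =>
          intro x y
          rw [pow_succ', pow_succ, Module.End.mul_apply, Module.End.mul_apply, ← ih,
            Matrix.toLin'_apply, Matrix.toLin'_apply, Matrix.mulVec_transpose,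
            dotProduct_comm _ (Matrix.vecMul _ _), ← Matrix.dotProduct_mulVec, dotProduct_comm]
      intro x y
      rw [← C_mul_X_pow_eq_monomial]
      simp only [map_mul, aeval_C, map_pow, aeval_X, Module.End.mul_apply,
        Module.algebraMap_end_apply, smul_dotProduct, dotProduct_smul, hm]
  have hε : ∀ x y, B x y = 1 * B y x := fun x y => by
    rw [hB, hB, one_mul, dotProduct_comm x.1, dotProduct_comm x.2, add_comm]
  have hnd : ∀ x, (∀ y, B x y = 0) → x = 0 := fun x hx => by
    refine Prod.ext (dotProduct_eq_zero _ fun y => ?_) (dotProduct_eq_zero _ fun y => ?_)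
    · simpa [hB] using hx (0, y)
    · simpa [hB] using hx (y, 0)
  obtain ⟨h, hh, hhB⟩ := exists_reversal (s := s) (ε := 1) (fun _ => rfl) (one_mul 1)
    (Module.finrank F ((Fin n → F) × (Fin n → F))) ((Fin n → F) × (Fin n → F)) B rfl (by
      rintro ⟨p, q⟩ ⟨x, y⟩ ⟨x', y'⟩
      change B (_ • _) _ = B _ ((q, p) • _)
      rw [hsmul, hsmul, hB, hB]
      have h2 := hadj Mᵀ q y x'
      rw [Matrix.transpose_transpose] at h2
      exact congrArg₂ _ (hadj M p x y') h2) hε hnd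
  let θ : (Fin n → F) →ₗ[F] (Fin n → F) :=
    LinearMap.snd F (Fin n → F) (Fin n → F) ∘ₗ h ∘ₗ LinearMap.inl F (Fin n → F) (Fin n → F)
  -- `s` exchanges the idempotents `(1, 0)` and `(0, 1)`, so `h` carries the first copy into the
  -- second.
  have hθ : ∀ x, h (x, 0) = (0, θ x) := fun x => by
    have h1 := hh (1, 0) (x, 0)
    rw [hsmul, map_one, map_zero] at h1
    have h2 : s (1, 0) • h (x, 0) = (0, θ x) := by
      change ((0, 1) : F[X] × F[X]) • ((h (x, 0)).1, (h (x, 0)).2) = _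
      rw [hsmul, map_one, map_zero]
      rfl
    exact h1.trans h2
  have hθM : ∀ x, θ (M *ᵥ x) = Mᵀ *ᵥ θ x := fun x => by
    have h1 := hh (X, 0) (x, 0)
    rw [hsmul, aeval_X, map_zero, hθ] at h1
    have h2 : s (X, 0) = (0, X) := rfl
    rw [h2, hsmul, aeval_X] at h1
    exact congrArg Prod.snd h1
  have hinj : Function.Injective θ := fun x y hxy => by
    have := injective_of_reversal hε hnd hhB ((hθ x).trans ((congrArg _ hxy).trans (hθ y).symm))
    exact congrArg Prod.fst this
  have hU : IsUnit (LinearMap.toMatrix' θ) := by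
    rw [← Matrix.mulVec_injective_iff_isUnit]
    intro x y hxy
    exact hinj (by simpa using hxy)
  refine ⟨hU.unit, ?_⟩
  refine Matrix.ext_of_mulVec_single fun i => ?_
  rw [IsUnit.unit_spec, ← Matrix.mulVec_mulVec, ← Matrix.mulVec_mulVec,
    LinearMap.toMatrix'_mulVec, LinearMap.toMatrix'_mulVec, hθM]

theorem isConj_inv_of_GL {F : Type*} [Field F] {n : ℕ} (x : GL (Fin n) F) :
    IsConj (SemidirectProduct.inl x : ExtByAut (GL (Fin n) F) (tau n F))
      (SemidirectProduct.inl x⁻¹) := by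
  obtain ⟨P, hP⟩ := exists_mul_eq_transpose_mul x.1
  have hP' : P * x = glTranspose x * P := Units.ext hP
  refine isConj_inl_of_mul_apply P⁻¹ ?_
  change P⁻¹ * (glTranspose x)⁻¹ * P⁻¹⁻¹ = x⁻¹
  rw [inv_inv, ← mul_inv_rev, ← hP']
  group

theorem isConj_inv_of_GU {F K : Type*} [Field F] [Fintype F] [Field K] [Algebra F K]
    (hK : Module.finrank F K = 2) {n : ℕ} (x : GU n F K) :
    IsConj (SemidirectProduct.inl x : ExtByAut (GU n F K) (tauGU n F K))
      (SemidirectProduct.inl x⁻¹) := by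
  have hfd : FiniteDimensional F K := FiniteDimensional.of_finrank_pos (by omega)
  have hfin : Finite K := Module.finite_of_finite F
  let σ : K →ₐ[F] K := FiniteField.frobeniusAlgHom F K
  have hσ : ∀ a, σ (σ a) = a := fun a => by
    have h1 : σ ^ 2 = 1 := by
      rw [← hK, ← FiniteField.orderOf_frobeniusAlgHom F K]
      exact pow_orderOf_eq_one σ
    rw [sq] at h1
    exact DFunLike.congr_fun h1 a
  have htr : ∀ a, Algebra.trace F K (σ a) = Algebra.trace F K a := fun a =>
    Algebra.trace_eq_of_algEquiv (AlgEquiv.ofAlgHom σ σ (AlgHom.ext hσ) (AlgHom.ext hσ)) a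
  have htr0 : ∀ a, (∀ b, Algebra.trace F K (b * a) = 0) → a = 0 := fun a ha =>
    (traceForm_nondegenerate F K).1 a fun b => by
      rw [Algebra.traceForm_apply, mul_comm]
      exact ha b
  let H : (Fin n → K) → (Fin n → K) → K := fun v w => (σ ∘ v) ⬝ᵥ w
  have hHσ : ∀ v w, σ (H v w) = H w v := fun v w => by
    simp only [H, dotProduct, map_sum, map_mul, Function.comp_apply, hσ, mul_comm]
  have hHs : ∀ (a : K) v w, H (a • v) w = σ a * H v w := fun a v w => by
    simp only [H, dotProduct, Function.comp_apply, Pi.smul_apply, smul_eq_mul, map_mul,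
      Finset.mul_sum, mul_assoc]
  have hHs' : ∀ (a : K) v w, H v (a • w) = a * H v w := fun a v w => by
    rw [← hHσ, hHs, map_mul, hσ, hHσ]
  have hHadd : ∀ v w w', H v (w + w') = H v w + H v w' := fun v w w' => dotProduct_add _ _ _
  have hHadd' : ∀ v v' w, H (v + v') w = H v w + H v' w := fun v v' w => by
    rw [← hHσ, hHadd, map_add, hHσ, hHσ]
  have hHF : ∀ (c : F) v w, H v (c • w) = c • H v w := fun c v w => by
    rw [← algebraMap_smul K c w, hHs', Algebra.smul_def]
  have hHF' : ∀ (c : F) v w, H (c • v) w = c • H v w := fun c v w => by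
    rw [← hHσ, hHF, map_smul, hHσ]
  let B : LinearMap.BilinForm F (Fin n → K) :=
    LinearMap.mk₂ F (fun v w => Algebra.trace F K (H v w))
      (fun v v' w => by rw [hHadd', map_add]) (fun c v w => by rw [hHF', map_smul])
      (fun v w w' => by rw [hHadd, map_add]) (fun c v w => by rw [hHF, map_smul])
  have hB : ∀ v w, B v w = Algebra.trace F K (H v w) := fun _ _ => rfl
  have hxx : (x.1.1.map σ)ᵀ * x.1.1 = 1 := congrArg Units.val x.2
  have hmul : ∀ (M : Matrix (Fin n) (Fin n) K) v, σ ∘ (M *ᵥ v) = (M.map σ) *ᵥ (σ ∘ v) :=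
    fun M v => funext fun i => RingHom.map_mulVec (σ : K →+* K) M v i
  have hHx : ∀ v w, H (x.1.1 *ᵥ v) (x.1.1 *ᵥ w) = H v w := fun v w => by
    change (σ ∘ _) ⬝ᵥ _ = (σ ∘ v) ⬝ᵥ w
    rw [hmul, Matrix.dotProduct_mulVec, ← Matrix.vecMul_transpose, Matrix.vecMul_vecMul, hxx,
      Matrix.vecMul_one]
  obtain ⟨h, hh, hhx, hhB⟩ := exists_reversal_of_isometry hσ (B := B) (ε := 1) (one_mul 1)
    (fun a v w => by rw [hB, hB, hHs, hHs'])
    (fun v w => by rw [hB, hB, one_mul, ← htr, hHσ])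
    (fun v hv => by
      have h0 : σ ∘ v = 0 := dotProduct_eq_zero _ fun w => htr0 _ fun b => by
        rw [← hHs', ← hB, hv]
      exact funext fun i => (map_eq_zero_iff σ σ.injective).1 (congrFun h0 i))
    (Matrix.GeneralLinearGroup.toLin x.1) (fun v w => by
      rw [hB, hB]
      exact congrArg _ (hHx v w))
  -- Scaling one argument by every `b` recovers `H` from its trace, the trace form being
  -- nondegenerate.
  have hhH : ∀ v w, H (h v) (h w) = H w v := fun v w => by
    rw [← sub_eq_zero]
    refine htr0 _ fun b => ?_
    have h1 := hhB v (σ b • w)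
    rw [hB, hB, hh, hσ, hHs', hHs, hσ] at h1
    rw [mul_sub, map_sub, h1, sub_self]
  let P : Matrix (Fin n) (Fin n) K := Matrix.of fun j i => h (Pi.single i 1) j
  have hP : ∀ v, h v = P *ᵥ (σ ∘ v) := fun v => by
    conv_lhs => rw [← Finset.univ_sum_single v]
    rw [map_sum]
    ext j
    rw [Finset.sum_apply, Matrix.mulVec, dotProduct]
    refine Finset.sum_congr rfl fun i _ => ?_
    have : Pi.single i (v i) = v i • (Pi.single i 1 : Fin n → K) := by
      rw [← Pi.single_smul, smul_eq_mul, mul_one]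
    rw [this, hh, Pi.smul_apply, smul_eq_mul, mul_comm]
    rfl
  have hPU : (P.map σ)ᵀ * P = 1 := by
    ext i j
    refine (hhH (Pi.single i 1) (Pi.single j 1)).trans ?_
    simp only [H]
    rw [dotProduct_single_one, Function.comp_apply, Pi.single_apply, Matrix.one_apply]
    split_ifs
    · exact map_one σ
    · exact map_zero σ
  let Q : GL (Fin n) K := ⟨P, (P.map σ)ᵀ, mul_eq_one_comm.1 hPU, hPU⟩
  have hQ : Q ∈ GU n F K := Units.ext hPU
  have hQx : Q * frob n F K x = x.1⁻¹ * Q := by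
    refine Units.ext (Matrix.ext_of_mulVec_single fun i => ?_)
    have h1 : h (x.1.1 *ᵥ Pi.single i 1) = (x.1⁻¹).1 *ᵥ h (Pi.single i 1) := hhx (Pi.single i 1)
    have h2 : σ ∘ (Pi.single i 1 : Fin n → K) = Pi.single i 1 := by
      ext j
      simp only [Function.comp_apply, Pi.single_apply]
      split_ifs
      · exact map_one σ
      · exact map_zero σ
    rw [hP, hmul, hP, h2, Matrix.mulVec_mulVec, Matrix.mulVec_mulVec] at h1
    exact h1
  -- The unitary condition says that Frobenius is `τ` on the group; this turns the semilinear
  -- relation `hQx` into conjugation in the extension.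
  have hfx : frob n F K x = tau n K x := by
    have h1 : glTranspose (frob n F K x.1) * x.1 = 1 := x.2
    change _ = (glTranspose x.1)⁻¹
    rw [← glTranspose_inv, ← eq_inv_of_mul_eq_one_left h1, glTranspose_glTranspose]
  refine isConj_inl_of_mul_apply ⟨Q, hQ⟩ (Subtype.ext ?_)
  change Q * tau n K x * Q⁻¹ = x.1⁻¹
  rw [← hfx, hQx, mul_inv_cancel_right]

end Matrices

/-! ### Artin–Schreier classes and Gauss sums in characteristic two. -/

section ArtinSchreier

variable {F : Type*} [Field F] [CharP F 2]

/-- The additive group of elements of the form `a ^ 2 + a` in a field of characteristic two. -/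
noncomputable def artinSchreierSubgroup (F : Type*) [Field F] [CharP F 2] : AddSubgroup F :=
  AddMonoidHom.range (AddMonoidHom.mk' (fun a : F => a ^ 2 + a) fun a b => by
    rw [CharTwo.add_sq]; ring)

theorem sq_add_self_mem (a : F) : a ^ 2 + a ∈ artinSchreierSubgroup F :=
  ⟨a, rfl⟩

/-- The map `a ↦ a ^ 2 + a` has kernel `{0, 1}`, and over a finite group the index of the range is
the order of the kernel. -/
theorem index_artinSchreierSubgroup [Finite F] : (artinSchreierSubgroup F).index = 2 := by
  rw [artinSchreierSubgroup, AddSubgroup.index_range, Nat.card_eq_two_iff]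
  refine ⟨⟨0, by simp⟩, ⟨1, ?_⟩, ?_, ?_⟩
  · simp [AddMonoidHom.mem_ker, CharTwo.add_self_eq_zero]
  · simp [Subtype.ext_iff]
  · refine Set.eq_univ_of_forall ?_
    rintro ⟨a, ha⟩
    have h : a * (a + 1) = 0 := by
      have : a ^ 2 + a = 0 := ha
      linear_combination this
    rcases mul_eq_zero.1 h with h | h
    · left; exact Subtype.ext h
    · right; exact Subtype.ext (CharTwo.add_eq_zero.1 h)

open Classical in
/-- The nontrivial additive character of a finite field of characteristic two that is invariant
under squaring. -/
noncomputable def artinSchreierSign (a : F) : ℤ := if a ∈ artinSchreierSubgroup F then 1 else -1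

theorem artinSchreierSign_add [Finite F] (a b : F) :
    artinSchreierSign (a + b) = artinSchreierSign a * artinSchreierSign b := by
  unfold artinSchreierSign
  rw [AddSubgroup.add_mem_iff_of_index_two index_artinSchreierSubgroup]
  by_cases ha : a ∈ artinSchreierSubgroup F <;> by_cases hb : b ∈ artinSchreierSubgroup F <;>
    simp [ha, hb]

theorem artinSchreierSign_mul_self (a : F) : artinSchreierSign a * artinSchreierSign a = 1 := by
  unfold artinSchreierSign
  split_ifs <;> rfl

theorem artinSchreierSign_zero : artinSchreierSign (0 : F) = 1 :=
  if_pos (zero_mem _)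

theorem artinSchreierSign_sq [Finite F] (a : F) :
    artinSchreierSign (a ^ 2) = artinSchreierSign a := by
  have h1 : artinSchreierSign (a ^ 2 + a) = 1 := if_pos (sq_add_self_mem a)
  rw [artinSchreierSign_add] at h1
  rw [← mul_one (artinSchreierSign (a ^ 2)), ← artinSchreierSign_mul_self a, ← mul_assoc, h1,
    one_mul]

theorem exists_artinSchreierSign_eq_neg_one [Finite F] : ∃ a : F, artinSchreierSign a = -1 := by
  by_contra! h
  have h1 : artinSchreierSubgroup F = ⊤ := by
    rw [eq_top_iff]
    intro a _
    by_contra ha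
    exact h a (if_neg ha)
  have h2 := index_artinSchreierSubgroup (F := F)
  rw [h1, AddSubgroup.index_top] at h2
  omega

variable {V : Type*} [AddCommGroup V] [Module F V]

theorem sum_artinSchreierSign_linear [Finite F] [Fintype V] {f : V →ₗ[F] F} (hf : f ≠ 0) :
    ∑ y, artinSchreierSign (f y) = 0 := by
  obtain ⟨a, ha⟩ := exists_artinSchreierSign_eq_neg_one (F := F)
  obtain ⟨z, rfl⟩ := LinearMap.surjective hf a
  have h := Fintype.sum_equiv (Equiv.addRight z) (fun y => artinSchreierSign (f (y + z)))
    (fun y => artinSchreierSign (f y)) fun _ => rfl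
  simp only [map_add, artinSchreierSign_add, ha, mul_neg, mul_one, Finset.sum_neg_distrib] at h
  omega

/-- The square of this Gauss sum is `|V|`: after the shift `x ↦ x + y`, the sum over `y` is that of
the character of `B x`, which vanishes unless `x = 0`. -/
theorem sum_artinSchreierSign_quadraticForm_ne_zero [Finite F] [Fintype V]
    {Q : QuadraticForm F V} (hnd : ∀ x, (∀ y, Q.polarBilin x y = 0) → x = 0) :
    ∑ x, artinSchreierSign (Q x) ≠ 0 := by
  intro h0
  have h1 : (∑ x, artinSchreierSign (Q x)) * ∑ x, artinSchreierSign (Q x) = Fintype.card V := by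
    calc (∑ x, artinSchreierSign (Q x)) * ∑ x, artinSchreierSign (Q x)
        = ∑ y, ∑ x, artinSchreierSign (Q (x + y)) * artinSchreierSign (Q y) := by
          rw [Finset.sum_mul_sum, Finset.sum_comm]
          exact Finset.sum_congr rfl fun y _ => (Fintype.sum_equiv (Equiv.addRight y) _
            (fun x => artinSchreierSign (Q x) * artinSchreierSign (Q y)) fun _ => rfl).symm
      _ = ∑ y, ∑ x, artinSchreierSign (Q x) * artinSchreierSign (Q.polarBilin x y) := by
          refine Finset.sum_congr rfl fun y _ => Finset.sum_congr rfl fun x _ => ?_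
          rw [QuadraticMap.map_add Q, artinSchreierSign_add, artinSchreierSign_add,
            mul_right_comm _ _ (artinSchreierSign (Q y)), mul_assoc _ _ (artinSchreierSign (Q y)),
            artinSchreierSign_mul_self, mul_one]
          rfl
      _ = ∑ x, artinSchreierSign (Q x) * ∑ y, artinSchreierSign (Q.polarBilin x y) := by
          rw [Finset.sum_comm]
          simp only [Finset.mul_sum]
      _ = artinSchreierSign (Q 0) * ∑ y, artinSchreierSign (Q.polarBilin 0 y) := by
          refine Finset.sum_eq_single 0 (fun x _ hx => ?_) (by simp)
          rw [sum_artinSchreierSign_linear, mul_zero]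
          exact fun h => hx (hnd x fun y => by rw [h, LinearMap.zero_apply])
      _ = Fintype.card V := by
          simp [artinSchreierSign_zero]
  rw [h0, mul_zero] at h1
  have : Fintype.card V ≠ 0 := Fintype.card_ne_zero
  omega

/-- If `Q` and `Q + B(·, z) ^ 2` are isometric, where `B` is the polar form of `Q`, then `Q z` has
trivial Artin–Schreier class. -/
theorem exists_sq_add_self_eq_of_isometry [Finite F] [Finite V] {Q : QuadraticForm F V}
    (hnd : ∀ x, (∀ y, Q.polarBilin x y = 0) → x = 0) (h : V ≃ₗ[F] V) (z : V)
    (hh : ∀ x, Q (h x) = Q x + Q.polarBilin x z ^ 2) : ∃ s, s ^ 2 + s = Q z := by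
  have := Fintype.ofFinite V
  have h1 : ∑ x, artinSchreierSign (Q x) =
      (∑ x, artinSchreierSign (Q x)) * artinSchreierSign (Q z) := by
    calc ∑ x, artinSchreierSign (Q x) = ∑ x, artinSchreierSign (Q (h x)) :=
          (Fintype.sum_equiv h.toEquiv _ _ fun _ => rfl).symm
      _ = ∑ x, artinSchreierSign (Q (x + z)) * artinSchreierSign (Q z) := by
          -- The sign does not see squaring, so `B(x, z) ^ 2` may be replaced by `B(x, z)`, which
          -- completes `Q x` to `Q (x + z)` up to `Q z`.
          refine Finset.sum_congr rfl fun x _ => ?_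
          rw [hh, QuadraticMap.map_add Q, artinSchreierSign_add, artinSchreierSign_add,
            artinSchreierSign_add, artinSchreierSign_sq, mul_right_comm,
            mul_assoc (artinSchreierSign (Q x)), artinSchreierSign_mul_self, mul_one]
          rfl
      _ = (∑ x, artinSchreierSign (Q x)) * artinSchreierSign (Q z) := by
          rw [← Finset.sum_mul]
          congr 1
          exact Fintype.sum_equiv (Equiv.addRight z) _ _ fun _ => rfl
  by_cases hz : Q z ∈ artinSchreierSubgroup F
  · exact hz
  · rw [artinSchreierSign, if_neg hz] at h1
    exact absurd (by omega) (sum_artinSchreierSign_quadraticForm_ne_zero hnd)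

/-- Squaring is an additive bijection of `F`, so taking the square root of `D` makes it linear. -/
theorem exists_linearMap_sq_eq [Finite F] (D : V → F) (hadd : ∀ x y, D (x + y) = D x + D y)
    (hsmul : ∀ (c : F) x, D (c • x) = c ^ 2 * D x) : ∃ f : V →ₗ[F] F, ∀ x, f x ^ 2 = D x := by
  have hsq : ∀ a : F, ∃ b, b ^ 2 = a := fun a => by
    obtain ⟨b, hb⟩ := FiniteField.isSquare_of_char_two (ringChar.eq F 2) a
    exact ⟨b, by rw [hb, sq]⟩
  choose r hr using hsq
  exact ⟨
    { toFun := fun x => r (D x)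
      map_add' := fun x y => CharTwo.sq_injective (by
        simp only [CharTwo.add_sq, hr, hadd])
      map_smul' := fun c x => CharTwo.sq_injective (by
        simp only [RingHom.id_apply, smul_eq_mul, mul_pow, hr, hsmul]) }, fun x => hr _⟩

end ArtinSchreier

/-! ### Orthogonal groups. -/

section Orthogonal

variable {F V : Type*} [Field F] [AddCommGroup V] [Module F V] {Q : QuadraticForm F V}

theorem polarBilin_comm (x y : V) : Q.polarBilin x y = Q.polarBilin y x :=
  QuadraticMap.polar_comm Q x y

theorem polarBilin_apply_of_mem_O {g : V ≃ₗ[F] V} (hg : g ∈ O Q) (x y : V) :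
    Q.polarBilin (g x) (g y) = Q.polarBilin x y := by
  change Q (g x + g y) - Q (g x) - Q (g y) = Q (x + y) - Q x - Q y
  rw [← map_add]
  have hg' : ∀ v, Q (g v) = Q v := hg
  rw [hg', hg', hg']

theorem mem_O_conj_of_two_ne_zero [FiniteDimensional F V] (h2 : (2 : F) ≠ 0)
    (hQ : QuadraticMap.Nondegenerate (Q := Q)) {g : V ≃ₗ[F] V} (hg : g ∈ O Q) :
    ∃ h ∈ O Q, h * g * h⁻¹ = g⁻¹ := by
  have hself : ∀ x, Q.polarBilin x x = 2 * Q x := fun x => by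
    refine (QuadraticMap.polar_self Q x).trans ?_
    rw [two_nsmul, two_mul]
  obtain ⟨h, hh, hB⟩ := exists_linearEquiv_reversal (B := Q.polarBilin) (one_mul (1 : F))
    (fun x y => by rw [one_mul, polarBilin_comm]) (fun x hx => by
      have h1 : x ∈ Q.radical := by
        refine ⟨?_, LinearMap.ext hx⟩
        exact (mul_eq_zero.1 ((hself x).symm.trans (hx x))).resolve_left h2
      rwa [hQ.radical_eq_bot, Submodule.mem_bot] at h1) g (polarBilin_apply_of_mem_O hg)
  refine ⟨h, fun v => ?_, hh⟩
  have h1 := hB v v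
  rw [hself, hself] at h1
  exact mul_left_cancel₀ h2 h1

variable [CharP F 2] [Finite F]

/-- The reversal `h` satisfies `Q (h x) = Q x + B(x, z) ^ 2` with `z` fixed by `g`. The isometry
lemma gives `Q z` trivial Artin–Schreier class, which is what solving for the correction `k`
requires. -/
theorem mem_O_conj_of_polar_nondegenerate [FiniteDimensional F V]
    (hnd : ∀ x, (∀ y, Q.polarBilin x y = 0) → x = 0) {g : V ≃ₗ[F] V} (hg : g ∈ O Q) :
    ∃ h ∈ O Q, h * g * h⁻¹ = g⁻¹ := by
  have hV : Finite V := Module.finite_of_finite F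
  have hgQ : ∀ v, Q (g v) = Q v := hg
  have hself : ∀ x, Q.polarBilin x x = 0 := fun x => by
    refine (QuadraticMap.polar_self Q x).trans ?_
    rw [two_nsmul, CharTwo.add_self_eq_zero]
  obtain ⟨h, hh, hB⟩ := exists_linearEquiv_reversal (B := Q.polarBilin) (one_mul (1 : F))
    (fun x y => by rw [one_mul, polarBilin_comm]) hnd g (polarBilin_apply_of_mem_O hg)
  have hhg : ∀ x, h (g x) = g⁻¹ (h x) := fun x =>
    LinearEquiv.congr_fun (mul_inv_eq_iff_eq_mul.1 hh) x
  have hginv : ∀ x, Q (g⁻¹ x) = Q x := (O Q).inv_mem hg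
  obtain ⟨f, hf⟩ := exists_linearMap_sq_eq (fun x => Q (h x) + Q x)
    (fun x y => by
      have h1 : QuadraticMap.polar Q (h x) (h y) = QuadraticMap.polar Q x y :=
        (hB x y).trans (polarBilin_comm _ _)
      rw [map_add, QuadraticMap.map_add Q, QuadraticMap.map_add Q, h1]
      linear_combination CharTwo.add_self_eq_zero (QuadraticMap.polar Q x y))
    (fun c x => by
      rw [map_smul, QuadraticMap.map_smul, QuadraticMap.map_smul, smul_eq_mul, smul_eq_mul]
      ring)
  have hsurj : Function.Surjective Q.polarBilin := by
    refine (LinearMap.injective_iff_surjective_of_finrank_eq_finrank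
      (Subspace.dual_finrank_eq (K := F) (V := V)).symm).1 ?_
    rw [injective_iff_map_eq_zero]
    exact fun x hx => hnd x fun y => by rw [hx, LinearMap.zero_apply]
  obtain ⟨z, rfl⟩ := hsurj f
  have hhQ : ∀ x, Q (h x) = Q x + Q.polarBilin x z ^ 2 := fun x => by
    rw [polarBilin_comm, hf]
    linear_combination - CharTwo.add_self_eq_zero (Q x)
  have hzg : ∀ x, Q.polarBilin z (g x) = Q.polarBilin z x := fun x =>
    CharTwo.sq_injective (by simp only [hf, hhg, hginv, hgQ])
  have hgz : g z = z := by
    rw [← sub_eq_zero]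
    refine hnd _ fun y => ?_
    obtain ⟨x, rfl⟩ := g.surjective y
    rw [map_sub, LinearMap.sub_apply, polarBilin_apply_of_mem_O hg, hzg, sub_self]
  obtain ⟨s, hs⟩ := exists_sq_add_self_eq_of_isometry hnd h z hhQ
  -- With `t = u⁻¹` the equation becomes `u ^ 2 + u = Q z`, solved by `u = s + 1`; if that is zero,
  -- then `Q z = 0` and `t = 1` works.
  obtain ⟨t, ht⟩ : ∃ t : F, 1 + t + t ^ 2 * Q z = 0 := by
    by_cases hs1 : s + 1 = 0
    · refine ⟨1, ?_⟩
      rw [← hs, show s ^ 2 + s = s * (s + 1) by ring, hs1, mul_zero, mul_zero, add_zero,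
        CharTwo.add_self_eq_zero]
    · refine ⟨(s + 1)⁻¹, ?_⟩
      rw [← hs]
      field_simp
      linear_combination (s + 1) * CharTwo.add_self_eq_zero (1 : F)
  -- By the choice of `t`, `k` changes `Q` by `B(z, x) ^ 2`, cancelling the defect of `h`; it
  -- commutes with `g` because `g` fixes `z`.
  let k : V →ₗ[F] V := LinearMap.id + t • (Q.polarBilin z).smulRight z
  have hk : ∀ x, k x = x + (t * Q.polarBilin z x) • z := fun x => by
    rw [mul_smul]; rfl
  have hmap : ∀ x, Q (h (k x)) = Q x := fun x => by
    have h1 : QuadraticMap.polar Q x ((t * Q.polarBilin z x) • z) =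
        t * Q.polarBilin z x * Q.polarBilin z x := by
      rw [polarBilin_comm z x]
      exact (Q.polarBilin x).map_smul _ _
    rw [hhQ, polarBilin_comm, hk, map_add (Q.polarBilin z), map_smul (Q.polarBilin z), hself,
      smul_zero, add_zero,
      QuadraticMap.map_add Q, h1, QuadraticMap.map_smul, smul_eq_mul]
    linear_combination Q.polarBilin z x ^ 2 * ht
  have hinj : Function.Injective (h.toLinearMap ∘ₗ k) := by
    rw [injective_iff_map_eq_zero]
    intro x hx
    have hkx : k x = 0 := h.map_eq_zero_iff.1 hx
    refine hnd x fun y => ?_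
    have h2 : Q.polarBilin (h (k x)) (h (k y)) = Q.polarBilin x y := by
      change Q (h (k x) + h (k y)) - Q (h (k x)) - Q (h (k y)) = Q (x + y) - Q x - Q y
      rw [← map_add, ← map_add, hmap, hmap, hmap]
    rw [← h2, hkx, map_zero, map_zero, LinearMap.zero_apply]
  refine ⟨LinearEquiv.ofInjectiveEndo _ hinj, hmap, ?_⟩
  rw [mul_inv_eq_iff_eq_mul]
  refine LinearEquiv.ext fun x => ?_
  change h (k (g x)) = g⁻¹ (h (k x))
  rw [← hhg]
  congr 1
  rw [hk, hk, map_add, map_smul, hgz, hzg]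

/-- Since `Q r ≠ 0`, a vector is determined by its projection to a complement `C` of the radical and
its value under `Q`. The map that `g` induces on `C` is reversed there, the reversal is lifted to an
isometry of `Q`, and the conjugation relation is checked on those two data. -/
theorem mem_O_conj_of_polar_ker_eq_span [FiniteDimensional F V] {r : V} (hr : Q r ≠ 0)
    (hker : LinearMap.ker Q.polarBilin = Submodule.span F {r}) {g : V ≃ₗ[F] V} (hg : g ∈ O Q) :
    ∃ h ∈ O Q, h * g * h⁻¹ = g⁻¹ := by
  have hgQ : ∀ v, Q (g v) = Q v := hg
  have hginv : ∀ x, Q (g⁻¹ x) = Q x := (O Q).inv_mem hg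
  have hgB := polarBilin_apply_of_mem_O hg
  obtain ⟨C, hC⟩ := Submodule.exists_isCompl (LinearMap.ker Q.polarBilin)
  let π : V →ₗ[F] C := C.projectionOnto _ hC.symm
  have hπker : ∀ x, π x = 0 ↔ ∃ c : F, c • r = x := fun x => by
    rw [← Submodule.mem_span_singleton, ← hker]
    exact Submodule.projectionOnto_apply_eq_zero_iff hC.symm
  have hπC : ∀ x : C, π x = x := fun x => Submodule.projectionOnto_apply_left hC.symm x
  have hrB : ∀ (c : F) y, Q.polarBilin (c • r) y = 0 := fun c y => by
    have : c • r ∈ LinearMap.ker Q.polarBilin := by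
      rw [hker]; exact Submodule.mem_span_singleton.2 ⟨c, rfl⟩
    rw [LinearMap.mem_ker.1 this, LinearMap.zero_apply]
  have hsub : ∀ x, ∃ c : F, c • r = x - π x := fun x => (hπker _).1 (by rw [map_sub, hπC, sub_self])
  have hπB : ∀ x y, Q.polarBilin (π x) y = Q.polarBilin x y := fun x y => by
    obtain ⟨c, hc⟩ := hsub x
    rw [eq_comm, ← sub_eq_zero, ← LinearMap.sub_apply, ← map_sub, ← hc, hrB]
  have hπB' : ∀ x y, Q.polarBilin x (π y) = Q.polarBilin x y := fun x y => by
    rw [polarBilin_comm, hπB, polarBilin_comm]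
  have hQr : ∀ x (c : F), Q (x + c • r) = Q x + c ^ 2 * Q r := fun x c => by
    have h1 : QuadraticMap.polar Q x (c • r) = 0 := (polarBilin_comm (Q := Q) _ _).trans (hrB c x)
    rw [QuadraticMap.map_add Q, h1, add_zero, QuadraticMap.map_smul, smul_eq_mul, sq]
  have huniq : ∀ x y, π x = π y → Q x = Q y → x = y := fun x y h1 h2 => by
    obtain ⟨c, hc⟩ := (hπker (x - y)).1 (by rw [map_sub, h1, sub_self])
    have h3 := hQr y c
    rw [hc, add_sub_cancel, h2, left_eq_add, mul_eq_zero] at h3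
    have hc0 := pow_eq_zero_iff two_ne_zero |>.1 (h3.resolve_right hr)
    rw [hc0, zero_smul] at hc
    exact sub_eq_zero.1 hc.symm
  have hnd : ∀ x : C, (∀ y : C, Q.polarBilin x y = 0) → x = 0 := fun x hx => by
    rw [← hπC x, hπker, ← Submodule.mem_span_singleton, ← hker, LinearMap.mem_ker]
    refine LinearMap.ext fun y => ?_
    rw [← hπB', hx, LinearMap.zero_apply]
  let gC₀ : C →ₗ[F] C := π ∘ₗ g.toLinearMap ∘ₗ C.subtype
  have hgC₀ : ∀ x, gC₀ x = π (g x) := fun _ => rfl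
  have hgCB : ∀ x y, Q.polarBilin (gC₀ x) (gC₀ y) = Q.polarBilin x y := fun x y => by
    rw [hgC₀, hgC₀, hπB, hπB', hgB]
  let gC : C ≃ₗ[F] C := LinearEquiv.ofInjectiveEndo gC₀ (by
    rw [injective_iff_map_eq_zero]
    intro x hx
    refine hnd x fun y => ?_
    rw [← hgCB, hx, Submodule.coe_zero, map_zero, LinearMap.zero_apply])
  obtain ⟨hC', hh, hB⟩ := exists_linearEquiv_reversal
    (B := LinearMap.BilinForm.restrict Q.polarBilin C)
    (one_mul (1 : F)) (fun x y => by rw [one_mul]; exact polarBilin_comm _ _) hnd gC hgCB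
  have hB : ∀ x y, Q.polarBilin (hC' x) (hC' y) = Q.polarBilin y x := hB
  have hhg : ∀ x, gC (hC' (gC x)) = hC' x := fun x => by
    have h1 : hC' (gC x) = gC⁻¹ (hC' x) := LinearEquiv.congr_fun (mul_inv_eq_iff_eq_mul.1 hh) x
    rw [h1]
    exact gC.apply_symm_apply _
  have hgπ : ∀ x, π (g x) = gC (π x) := fun x => by
    refine sub_eq_zero.1 (hnd _ fun y => ?_)
    change Q.polarBilin (_ - _ : V) y = 0
    change Q.polarBilin (π (g x) - π (g (π x)) : V) y = 0
    obtain ⟨w, hw⟩ := g.surjective y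
    rw [map_sub, LinearMap.sub_apply, hπB, hπB, ← hw, hgB, hgB, hπB, sub_self]
  let ψ : V →ₗ[F] V := C.subtype ∘ₗ hC'.toLinearMap ∘ₗ π
  have hψ : ∀ x, ψ x = hC' (π x) := fun _ => rfl
  -- Adding `f x • r` to `ψ x` changes `Q` by `f x ^ 2 * Q r`, so this `f` restores the value `Q x`.
  obtain ⟨f, hf⟩ := exists_linearMap_sq_eq (fun x => (Q x + Q (ψ x)) / Q r)
    (fun x y => by
      have h1 : QuadraticMap.polar Q (ψ x) (ψ y) = QuadraticMap.polar Q x y :=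
        (hB (π x) (π y)).trans (by
          rw [hπB, hπB', polarBilin_comm]
          rfl)
      rw [map_add ψ, QuadraticMap.map_add Q, QuadraticMap.map_add Q, h1]
      linear_combination CharTwo.add_self_eq_zero (QuadraticMap.polar Q x y) / Q r)
    (fun c x => by
      rw [map_smul ψ, QuadraticMap.map_smul, QuadraticMap.map_smul, smul_eq_mul, smul_eq_mul]
      ring)
  let h : V →ₗ[F] V := ψ + f.smulRight r
  have hhx : ∀ x, h x = ψ x + f x • r := fun _ => rfl
  have hhQ : ∀ x, Q (h x) = Q x := fun x => by
    rw [hhx, hQr, hf, div_mul_cancel₀ _ hr]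
    linear_combination CharTwo.add_self_eq_zero (Q (ψ x))
  have hhπ : ∀ x, π (h x) = hC' (π x) := fun x => by
    rw [hhx, map_add, (hπker _).2 ⟨_, rfl⟩, add_zero, hψ, hπC]
  have hinj : Function.Injective h := fun x y hxy => by
    refine huniq x y (hC'.injective ?_) ?_
    · rw [← hhπ, hxy, hhπ]
    · rw [← hhQ, hxy, hhQ]
  refine ⟨LinearEquiv.ofInjectiveEndo h hinj, hhQ, ?_⟩
  rw [mul_inv_eq_iff_eq_mul]
  refine LinearEquiv.ext fun x => ?_
  change h (g x) = g⁻¹ (h x)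
  have hgg : ∀ v, g (g⁻¹ v) = v := fun v => g.apply_symm_apply v
  refine huniq _ _ (gC.injective ?_) ?_
  · rw [hhπ, hgπ, hhg, ← hgπ, hgg, hhπ]
  · rw [hhQ, hginv, hgQ, hhQ]

end Orthogonal

theorem exists_mem_O_conj_eq_inv {F V : Type*} [Field F] [Finite F] [AddCommGroup V] [Module F V]
    [FiniteDimensional F V] {Q : QuadraticForm F V} (hQ : QuadraticMap.Nondegenerate (Q := Q))
    {g : V ≃ₗ[F] V} (hg : g ∈ O Q) : ∃ h ∈ O Q, h * g * h⁻¹ = g⁻¹ := by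
  by_cases h2 : (2 : F) = 0
  · have : CharP F 2 := CharTwo.of_one_ne_zero_of_two_eq_zero one_ne_zero h2
    obtain ⟨r, hr, hle⟩ := (rank_submodule_le_one_iff _).1 hQ.rank_rad_polar_le
    have hker : LinearMap.ker Q.polarBilin = Submodule.span F {r} :=
      le_antisymm hle ((Submodule.span_singleton_le_iff_mem _ _).2 hr)
    by_cases hr0 : r = 0
    · refine mem_O_conj_of_polar_nondegenerate (fun x hx => ?_) hg
      have h1 : x ∈ LinearMap.ker Q.polarBilin := LinearMap.ext hx
      rwa [hker, hr0, Submodule.span_zero_singleton, Submodule.mem_bot] at h1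
    · refine mem_O_conj_of_polar_ker_eq_span (fun hQr => hr0 ?_) hker hg
      have h1 : r ∈ Q.radical := ⟨hQr, hr⟩
      rwa [hQ.radical_eq_bot, Submodule.mem_bot] at h1
  · exact mem_O_conj_of_two_ne_zero h2 hQ hg

end ClassicalReality

/-- Here `F` is the field with `q` elements and `n ≥ 2`; `K` is the field with `q²` elements.
In the last part `Q` runs over all nondegenerate quadratic forms on an `n`-dimensional space, in
any characteristic, so `O Q` runs over `O^+(n,q)` and `O^-(n,q)` for `n` even and over
`O^∘(n,q)` for `n` odd. -/
theorem theorem2p1 (F : Type*) [Field F] [Fintype F] (n : ℕ) (hn : 2 ≤ n) :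
    (∀ x : GL (Fin n) F,
      IsConj (SemidirectProduct.inl x :
          ClassicalReality.ExtByAut (GL (Fin n) F) (ClassicalReality.tau n F))
        (SemidirectProduct.inl x⁻¹)) ∧
    (∀ (K : Type*) [Field K] [Algebra F K], Module.finrank F K = 2 →
      ∀ x : ClassicalReality.GU n F K,
        IsConj (SemidirectProduct.inl x :
            ClassicalReality.ExtByAut (ClassicalReality.GU n F K)
              (ClassicalReality.tauGU n F K))
          (SemidirectProduct.inl x⁻¹)) ∧
    (∀ (V : Type*) [AddCommGroup V] [Module F V], Module.finrank F V = 2 * n →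
      ∀ B : LinearMap.BilinForm F V, B.IsAlt → B.Nondegenerate →
        ∀ g ∈ ClassicalReality.Sp B, ∃ h ∈ ClassicalReality.CSp B, h * g * h⁻¹ = g⁻¹) ∧
    (∀ (V : Type*) [AddCommGroup V] [Module F V], Module.finrank F V = n →
      ∀ Q : QuadraticForm F V, QuadraticMap.Nondegenerate (Q := Q) →
        ∀ g ∈ ClassicalReality.O Q, ∃ h ∈ ClassicalReality.O Q, h * g * h⁻¹ = g⁻¹) := by
  refine ⟨ClassicalReality.isConj_inv_of_GL, ?_, ?_, ?_⟩
  · intro K _ _ hK x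
    exact ClassicalReality.isConj_inv_of_GU hK x
  · intro V _ _ hV B hB hnd g hg
    have : FiniteDimensional F V := FiniteDimensional.of_finrank_pos (by omega)
    exact ClassicalReality.exists_mem_CSp_conj_eq_inv hB hnd hg
  · intro V _ _ hV Q hQ g hg
    have : FiniteDimensional F V := FiniteDimensional.of_finrank_pos (by omega)
    exact ClassicalReality.exists_mem_O_conj_eq_inv hQ hg
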